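/- **Theorem 1.1.** Assume the Continuum Hypothesis, $2^{\omega}=\omega_1$. Suppose that at least one of the following holds: 1. there exists an $\omega_1$-Kurepa tree, that is, a tree $T$ (a partially ordered set in which the strict predecessors of each element are well-ordered; the $\alpha$-th level consists of the elements whose set of strict predecessors has order type $\alpha$) of height $\omega_1$, all of whose levels are countable, and which has strictly more than $\omega_1$ cofinal branches (maximal chains that meet every level $\alpha<\omega_1$); 2. Todorčević's square principle $\square(\omega_2)$ holds, that is, there is a sequence $\langle c_\alpha \mid \alpha<\omega_2\rangle$ such that for each $\alpha<\omega_2$ the set $c_\alpha$ is closed and unbounded in $\alpha$ (for a successor $\alpha=\gamma+1$ this means closed with $\gamma\in c_\alpha$), $c_\beta=c_\alpha\cap\beta$ for every limit point $\beta<\alpha$ of $c_\alpha$, and there is no closed unbounded set $D\subseteq\omega_2$ such that $D\cap\alpha=c_\alpha$ for every limit point $\alpha<\omega_2$ of $D$. Then there are regular $T_1$ Lindelöf spaces $X_0,X_1$, in each of which every singleton is a $G_\delta$ set, such that $$e(X_0\times X_1)>2^{\omega},$$ where the extent $e(X)$ of a space $X$ is $\sup\{|C| : C\subseteq X \text{ is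 closed and discrete}\}$. -/

import Mathlib

open scoped Cardinal Ordinal

/-- The extent `e(X)`: the supremum of the cardinalities of the closed discrete subsets of `X`.
(The family is indexed by a type in the universe of `X`, hence bounded, so that the supremum
is a true least upper bound.) -/
noncomputable def extent (X : Type*) [TopologicalSpace X] : Cardinal :=
  ⨆ C : {C : Set X // IsClosed C ∧ DiscreteTopology C}, #C.1

/-- A partially ordered set is a (set-theoretic) tree if the strict predecessors of each of its
elements are well-ordered. -/
class IsSetTree (T : Type*) [PartialOrder T] : Prop where
  isWellOrder_Iio : ∀ t : T, IsWellOrder (Set.Iio t) (· < ·)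

/-- The height of a node `t` of a tree: the order type of the set of its strict predecessors. -/
noncomputable def treeHeight {T : Type*} [PartialOrder T] [IsSetTree T] (t : T) : Ordinal :=
  @Ordinal.type (Set.Iio t) (· < ·) (IsSetTree.isWellOrder_Iio t)

/-- The `α`-th level of a tree: the set of all its nodes of height `α`. -/
def treeLevel (T : Type*) [PartialOrder T] [IsSetTree T] (α : Ordinal) : Set T :=
  {t | treeHeight t = α}

/-- An `ω₁`-tree: a tree of height `ω₁` (a level is non-empty exactly if its index is
below `ω₁`) all of whose levels are countable. -/
structure IsOmegaOneTree (T : Type*) [PartialOrder T] [IsSetTree T] : Prop where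
  level_nonempty_iff : ∀ α : Ordinal, (treeLevel T α).Nonempty ↔ α < ω₁
  level_countable : ∀ α : Ordinal, (treeLevel T α).Countable

/-- A cofinal branch of an `ω₁`-tree: a maximal chain that meets every level below `ω₁`. -/
structure IsCofinalBranch {T : Type*} [PartialOrder T] [IsSetTree T] (B : Set T) : Prop where
  isMaxChain : IsMaxChain (· ≤ ·) B
  meets : ∀ α : Ordinal, α < ω₁ → (B ∩ treeLevel T α).Nonempty

/-- An `ω₁`-Kurepa tree: an `ω₁`-tree with strictly more than `ω₁` cofinal branches. -/
structure IsKurepaTree (T : Type*) [PartialOrder T] [IsSetTree T] : Prop where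
  isOmegaOneTree : IsOmegaOneTree T
  card_branches : ℵ₁ < #{B : Set T // IsCofinalBranch B}

/-- `c` is a closed unbounded subset of the ordinal `α = {β | β < α}`. -/
def IsClubIn (c : Set Ordinal) (α : Ordinal) : Prop :=
  c ⊆ Set.Iio α ∧ IsClub (Subtype.val ⁻¹' c : Set (Set.Iio α))

/-- Todorčević's square principle `□(κ)`. The limit points of a set of ordinals are its
accumulation points in the order topology. -/
def TodorcevicSquare (κ : Ordinal) : Prop :=
  ∃ c : Ordinal → Set Ordinal,
    (∀ α < κ, IsClubIn (c α) α) ∧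
    (∀ α < κ, ∀ β < α, AccPt β (Filter.principal (c α)) → c β = c α ∩ Set.Iio β) ∧
    ¬ ∃ D : Set Ordinal, IsClubIn D κ ∧
      ∀ α < κ, AccPt α (Filter.principal D) → D ∩ Set.Iio α = c α

/-!
Let `T` be a tree of sequences of natural numbers, indexed by a well-order, which is thin: near its
end a node of length `δ` agrees with one of countably many functions. Suppose that no full-length
sequence is a branch of `T`, but that `T` has more than `ω₁` paths of uncountable cofinality. Turn
the paths into a space. A path of uncountable cofinality carries a copy of the Sorgenfrey line, a
maximal path of countable cofinality at most a single point. A neighbourhood of a point `y` on the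
path `z` consists of the points of `z` in an open set `O ∋ y` and of the paths which leave `z` late,
at a place `α` whose anchor lies in `O`. The anchors of `z` run through a fixed injective
`ω₁`-sequence of points of the line, each of which is used only boundedly often below `z`.

Such a space is Lindelöf. From an open cover without a countable subcover one extracts a countable
perfect set of nodes none of whose cones is countably covered. Thinness gives it uncountably many
limit paths outside `T`; the neighbourhood of a point on one of them swallows a whole cone.

By CH the limit paths of countable cofinality can be split into two parts, each of which still meets
every uncountable family that arises in this way. The two spaces use one part each, and the
sequences `yᵢ` and `-yᵢ` as anchors. The diagonal, one pair for every path of uncountable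
cofinality, is then closed and discrete in the product, because `(yᵢ, -yᵢ)` is closed and discrete
in the Sorgenfrey plane.

For a Kurepa tree, `T` consists of the initial segments of its suitably coded cofinal branches.
For `□(ω₂)` it consists of the initial segments of the functions sending `ξ < α` to the number of
steps of the walk from `α` to `ξ`. These cohere up to an eventual additive constant, which gives
thinness, and nontriviality of the square sequence forbids a full-length branch.
-/

open scoped Topology

universe u

/-! ### Well-orders and cofinality -/

/-- An element of uncountable cofinality: no countable set is cofinal below it. In particular it is
a limit. -/
def HasUncountableCof {W : Type*} [LinearOrder W] (γ : W) : Prop :=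
  ℵ₀ < Order.cof (Set.Iio γ)

section WellOrder

variable {W : Type*} [LinearOrder W] {γ : W}

theorem hasUncountableCof_iff :
    HasUncountableCof γ ↔ ∀ s ⊆ Set.Iio γ, s.Countable → ∃ η < γ, ∀ ξ ∈ s, ξ < η := by
  constructor
  · intro h s hsγ hs
    have hcard : #(Subtype.val ⁻¹' s : Set (Set.Iio γ)) ≤ ℵ₀ :=
      Cardinal.le_aleph0_iff_set_countable.2 (hs.preimage Subtype.val_injective)
    have hcof : ¬ IsCofinal (Subtype.val ⁻¹' s : Set (Set.Iio γ)) := fun hcof =>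
      (h.trans_le (Order.cof_le hcof)).not_ge hcard
    obtain ⟨η, hη⟩ := not_isCofinal_iff.1 hcof
    exact ⟨η, η.2, fun ξ hξ => hη ⟨ξ, hsγ hξ⟩ hξ⟩
  · intro h
    obtain ⟨s, hs, hcard⟩ := Order.exists_cof_eq (Set.Iio γ)
    by_contra hle
    rw [HasUncountableCof, not_lt, ← hcard, Cardinal.le_aleph0_iff_set_countable] at hle
    obtain ⟨η, hη, hlt⟩ := h (Subtype.val '' s) (by simp) (hle.image _)
    obtain ⟨ξ, hξ, hle⟩ := hs ⟨η, hη⟩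
    exact (hlt ξ ⟨ξ, hξ, rfl⟩).not_ge hle

theorem exists_countable_of_not_hasUncountableCof (h : ¬ HasUncountableCof γ) :
    ∃ s ⊆ Set.Iio γ, s.Countable ∧ ∀ η < γ, ∃ ξ ∈ s, η ≤ ξ := by
  simpa [hasUncountableCof_iff] using h

theorem HasUncountableCof.exists_forall_lt (h : HasUncountableCof γ) {s : Set W}
    (hsγ : s ⊆ Set.Iio γ) (hs : s.Countable) : ∃ η < γ, ∀ ξ ∈ s, ξ < η :=
  hasUncountableCof_iff.1 h s hsγ hs

theorem HasUncountableCof.isSuccLimit (h : HasUncountableCof γ) : Order.IsSuccLimit γ := by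
  refine ⟨fun hmin => ?_, fun ξ hξ => ?_⟩
  · obtain ⟨η, hη, -⟩ := h.exists_forall_lt (Set.empty_subset _) Set.countable_empty
    exact (hmin.not_lt hη)
  · obtain ⟨η, hη, hlt⟩ := h.exists_forall_lt (s := {ξ}) (by simpa using hξ.lt)
      (Set.countable_singleton ξ)
    exact hξ.2 (hlt ξ rfl) hη

/-- The fibres of `ψ` below `l` are bounded in `l`, yet `ψ` is left-continuous, for the discrete
topology of `I`, at all places of uncountable cofinality below `l`. -/
def IsRankMap {I : Type*} (l : W) (ψ : W → I) : Prop :=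
  (∀ i, ∃ b < l, ∀ α < l, ψ α = i → α ≤ b) ∧
    ∀ μ < l, HasUncountableCof μ → ∃ η < μ, ∀ α ∈ Set.Ioc η μ, ψ α = ψ μ

/-- For `α < l`, `ψ α` is the least rank of an element of `[α, l)`. -/
theorem exists_isRankMap {I : Type*} [LinearOrder I] [WellFoundedLT I]
    (hI : ∀ i : I, (Set.Iio i).Countable) {l : W} (hl : ¬ IsMin l) (rank : Set.Iio l ↪ I) :
    ∃ ψ : W → I, IsRankMap l ψ := by
  obtain ⟨a, ha⟩ := not_isMin_iff.1 hl
  have hleast (α : W) : ∃ i, α < l → IsLeast (rank '' {β | α ≤ β}) i := by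
    by_cases hα : α < l
    · have hne : (rank '' {β | α ≤ β}).Nonempty := ⟨_, ⟨α, hα⟩, le_rfl, rfl⟩
      exact ⟨_, fun _ => ⟨wellFounded_lt.min_mem _ hne, fun _ => wellFounded_lt.min_le⟩⟩
    · exact ⟨rank ⟨a, ha⟩, fun h => absurd h hα⟩
  choose ψ hψ using hleast
  refine ⟨ψ, fun i => ?_, fun μ hμ hcof => ?_⟩
  · by_cases hi : ∃ β, rank β = i
    · obtain ⟨β, rfl⟩ := hi
      refine ⟨β, β.2, fun α hα h => ?_⟩
      obtain ⟨β', hle, heq⟩ := (hψ α hα).1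
      rwa [rank.injective (heq.trans h)] at hle
    · exact ⟨a, ha, fun α hα h => absurd ((hψ α hα).1.imp fun _ hβ => hβ.2.trans h) hi⟩
  · have hsmall : (Subtype.val '' (rank ⁻¹' Set.Iio (ψ μ)) ∩ Set.Iio μ).Countable :=
      (((hI _).preimage rank.injective).image _).mono Set.inter_subset_left
    obtain ⟨η, hη, hlt⟩ := hcof.exists_forall_lt Set.inter_subset_right hsmall
    refine ⟨η, hη, fun α hα => ?_⟩
    have hαl := hα.2.trans_lt hμ
    obtain ⟨β, hβ, hβψ⟩ := (hψ α hαl).1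
    refine le_antisymm ((hψ α hαl).2 (Set.image_mono (fun _ h => hα.2.trans h) (hψ μ hμ).1)) ?_
    rcases lt_or_ge β.1 μ with hβμ | hβμ
    · by_contra! hψlt
      exact (hα.1.trans_le hβ).not_gt (hlt β ⟨⟨β, by simpa [hβψ] using hψlt, rfl⟩, hβμ⟩)
    · exact hβψ ▸ (hψ μ hμ).2 ⟨β, hβμ, rfl⟩

end WellOrder

/-! ### Splitting families of large sets -/

theorem exists_injective_forall_mem {ι α : Type u} {S : ι → Set α} (hS : ∀ i, #ι ≤ #(S i)) :
    ∃ f : ι → α, Function.Injective f ∧ ∀ i, f i ∈ S i := by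
  obtain ⟨e⟩ : Nonempty ((#ι).ord.ToType ≃ ι) := Cardinal.eq.1 (Cardinal.mk_ord_toType _)
  have hnew (i : (#ι).ord.ToType) (g : ∀ j, j < i → α) :
      ∃ a ∈ S (e i), ∀ j (h : j < i), g j h ≠ a := by
    have hlt : #(Set.range fun j : Set.Iio i => g j j.2) < #(S (e i)) :=
      (Cardinal.mk_range_le.trans_lt (by simpa using Cardinal.mk_Iio_lt i)).trans_le (hS _)
    obtain ⟨a, ha, hag⟩ := Set.not_subset.1 fun h => hlt.not_ge (Cardinal.mk_le_mk_of_subset h)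
    exact ⟨a, ha, fun j h heq => hag ⟨⟨j, h⟩, heq⟩⟩
  choose new hmem hne using hnew
  let f : (#ι).ord.ToType → α := wellFounded_lt.fix new
  have hf (i) : f i = new i fun j _ => f j := wellFounded_lt.fix_eq new i
  have hinj : Function.Injective f := Function.Injective.of_lt_imp_ne fun i j h => by
    simpa only [← hf j] using hne j (fun k _ => f k) i h
  refine ⟨f ∘ e.symm, hinj.comp e.symm.injective, fun i => ?_⟩
  rw [Function.comp_apply, hf]
  simpa using hmem (e.symm i) fun j _ => f j

theorem exists_splitting_set {ι α : Type u} (hι : #ι ≤ ℵ₁) {S : ι → Set α}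
    (hS : ∀ i, ¬ (S i).Countable) :
    ∃ P : Set α, ∀ i, (S i ∩ P).Nonempty ∧ (S i ∩ Pᶜ).Nonempty := by
  have hcard (i : ι) : ℵ₁ ≤ #(S i) := by
    rw [← Cardinal.succ_aleph0, Order.succ_le_iff, ← not_le, Cardinal.le_aleph0_iff_set_countable]
    exact hS i
  have hprod : #(ι × ULift.{u} Bool) ≤ ℵ₁ := by
    rw [Cardinal.mk_prod, Cardinal.lift_id, Cardinal.lift_id]
    exact Cardinal.mul_le_of_le (Cardinal.aleph0_le_aleph 1) hι
      (Cardinal.mk_le_aleph0.trans (Cardinal.aleph0_le_aleph 1))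
  obtain ⟨f, hf, hfS⟩ := exists_injective_forall_mem (ι := ι × ULift.{u} Bool)
    (S := fun i => S i.1) fun i => hprod.trans (hcard i.1)
  refine ⟨Set.range fun i => f (i, ⟨true⟩), fun i => ⟨⟨_, hfS (i, ⟨true⟩), i, rfl⟩,
    ⟨f (i, ⟨false⟩), hfS (i, ⟨false⟩), ?_⟩⟩⟩
  rintro ⟨j, hj⟩
  simpa using hf hj

/-! ### The Sorgenfrey line -/

/-- The real line with the topology generated by the intervals `[x, b)`. -/
def SorgenfreyLine : Type := ℝ

namespace SorgenfreyLine

/-- The identity map, under which the topologies of `SorgenfreyLine` and `ℝ` differ. -/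
def toReal : SorgenfreyLine ≃ ℝ := Equiv.refl ℝ

instance : TopologicalSpace SorgenfreyLine :=
  .mkOfNhds fun x => (𝓝[≥] toReal x).comap toReal

theorem isOpen_iff {U : Set SorgenfreyLine} :
    IsOpen U ↔ ∀ x ∈ U, ∃ b > toReal x, toReal ⁻¹' Set.Ico (toReal x) b ⊆ U := by
  refine forall₂_congr fun x _ => ?_
  rw [Filter.mem_comap_iff toReal.injective (by simp), mem_nhdsGE_iff_exists_Ico_subset]
  exact exists_congr fun b => and_congr Iff.rfl (by
    rw [← toReal.preimage_subset, toReal.preimage_image])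

theorem isClopen_preimage_Ico (a b : ℝ) : IsClopen (toReal ⁻¹' Set.Ico a b) := by
  refine ⟨⟨isOpen_iff.2 fun x hx => ?_⟩, isOpen_iff.2 fun x hx => ?_⟩
  · rcases lt_or_ge (toReal x) a with ha | ha
    · exact ⟨a, ha, fun y hy hy' => hy.2.not_ge hy'.1⟩
    · have hb : b ≤ toReal x := not_lt.1 fun hb => hx ⟨ha, hb⟩
      exact ⟨toReal x + 1, by simp, fun y hy hy' => (hb.trans hy.1).not_gt hy'.2⟩
  · exact ⟨b, hx.2, fun y hy => ⟨hx.1.trans hy.1, hy.2⟩⟩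

instance : RegularSpace SorgenfreyLine := .of_exists_mem_nhds_isClosed_subset fun x s hs => by
  obtain ⟨U, hUs, hU, hxU⟩ := mem_nhds_iff.1 hs
  obtain ⟨b, hb, hbU⟩ := isOpen_iff.1 hU x hxU
  exact ⟨_, (isClopen_preimage_Ico _ b).isOpen.mem_nhds ⟨le_rfl, hb⟩,
    (isClopen_preimage_Ico _ _).isClosed, hbU.trans hUs⟩

theorem continuous_toReal : Continuous toReal := by
  refine continuous_def.2 fun U hU => isOpen_iff.2 fun x hx => ?_
  exact (mem_nhdsGE_iff_exists_Ico_subset.1 (nhdsWithin_le_nhds (hU.mem_nhds hx))).imp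
    fun b hb => ⟨hb.1, Set.preimage_mono hb.2⟩

instance : T1Space SorgenfreyLine :=
  t1Space_of_injective_of_continuous toReal.injective continuous_toReal

theorem isGδ_singleton (x : SorgenfreyLine) : IsGδ {x} := by
  simpa [toReal.injective.preimage_image, ← Set.image_singleton] using
    (IsGδ.singleton (toReal x)).preimage continuous_toReal

instance : LindelofSpace SorgenfreyLine := by
  refine ⟨isLindelof_of_countable_subcover fun {ι} U hU hcov => ?_⟩
  choose i hi using fun x : ℝ => Set.mem_iUnion.1 (hcov (Set.mem_univ (toReal.symm x)))
  choose e he hsub using fun x => isOpen_iff.1 (hU (i x)) _ (hi x)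
  simp only [toReal.apply_symm_apply] at he hsub
  set V := ⋃ x, Set.Ioo x (e x) with hV
  obtain ⟨t, ht, htV⟩ := TopologicalSpace.isOpen_iUnion_countable (fun x => Set.Ioo x (e x))
    fun _ => isOpen_Ioo
  -- The intervals `(x, e x)` for `x ∉ V` are pairwise disjoint, since none of them contains such
  -- an endpoint.
  have hVc : (Vᶜ).Countable := by
    refine Set.PairwiseDisjoint.countable_of_Ioo (y := e) (fun x hx y hy hxy => ?_) fun x _ => he x
    refine Set.disjoint_left.2 fun z hz hz' => ?_
    rcases lt_or_gt_of_ne hxy with h | h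
    · exact hy (Set.mem_iUnion.2 ⟨x, h, hz'.1.trans hz.2⟩)
    · exact hx (Set.mem_iUnion.2 ⟨y, h, hz.1.trans hz'.2⟩)
  refine ⟨i '' (t ∪ Vᶜ), (ht.union hVc).image _, fun x _ => ?_⟩
  rw [Set.biUnion_image]
  by_cases hx : toReal x ∈ V
  · rw [hV, ← htV] at hx
    obtain ⟨y, hy, hxy⟩ := Set.mem_iUnion₂.1 hx
    exact Set.mem_iUnion₂.2 ⟨y, Or.inl hy, hsub y ⟨hxy.1.le, hxy.2⟩⟩
  · exact Set.mem_iUnion₂.2 ⟨_, Or.inr hx, hi (toReal x)⟩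

theorem exists_isOpen_antidiagonal_subsingleton (y z : SorgenfreyLine) :
    ∃ U V : Set SorgenfreyLine, IsOpen U ∧ IsOpen V ∧ y ∈ U ∧ z ∈ V ∧
      {a : ℝ | toReal.symm a ∈ U ∧ toReal.symm (-a) ∈ V}.Subsingleton := by
  set u := toReal y
  set v := toReal z
  obtain ⟨ε, hε, hsum⟩ : ∃ ε > 0, u + v < 0 → u + v + 2 * ε ≤ 0 := by
    rcases lt_or_ge (u + v) 0 with h | h
    · exact ⟨-(u + v) / 2, by linarith, fun _ => by linarith⟩
    · exact ⟨1, one_pos, fun h' => absurd h' h.not_gt⟩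
  refine ⟨toReal ⁻¹' Set.Ico u (u + ε), toReal ⁻¹' Set.Ico v (v + ε),
    (isClopen_preimage_Ico _ _).isOpen, (isClopen_preimage_Ico _ _).isOpen,
    ⟨le_rfl, lt_add_of_pos_right u hε⟩, ⟨le_rfl, lt_add_of_pos_right v hε⟩, ?_⟩
  rintro a ⟨⟨hua, hau⟩, hva, hav⟩ b ⟨⟨hub, hbu⟩, hvb, hbv⟩
  simp only [toReal.apply_symm_apply] at hua hau hva hav hub hbu hvb hbv
  have : 0 ≤ u + v := not_lt.1 fun h => by linarith [hsum h]
  linarith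

end SorgenfreyLine

/-! ### Sequences indexed by initial segments of a well-order -/

/-- A sequence of natural numbers defined on the initial segment of `W` below `len`. It is encoded
by a total function that vanishes from `len` on, so that equal sequences have equal encodings. -/
@[ext]
structure InitSeq (W : Type*) [LinearOrder W] where
  len : W
  val : W → ℕ
  val_eq_zero : ∀ ξ, len ≤ ξ → val ξ = 0

namespace InitSeq

variable {W : Type*} [LinearOrder W] {z w : InitSeq W} {h h' : W → ℕ} {α β γ : W}

theorem eq_of_eqOn (hlen : z.len = w.len) (hval : Set.EqOn z.val w.val (Set.Iio z.len)) :
    z = w := by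
  refine InitSeq.ext hlen (funext fun ξ => ?_)
  rcases lt_or_ge ξ z.len with hξ | hξ
  · exact hval hξ
  · rw [z.val_eq_zero ξ hξ, w.val_eq_zero ξ (hlen ▸ hξ)]

instance : PartialOrder (InitSeq W) where
  le z w := z.len ≤ w.len ∧ Set.EqOn z.val w.val (Set.Iio z.len)
  le_refl z := ⟨le_rfl, Set.eqOn_refl _ _⟩
  le_trans _ _ _ h h' :=
    ⟨h.1.trans h'.1, h.2.trans (h'.2.mono (Set.Iio_subset_Iio h.1))⟩
  le_antisymm _ _ h h' := eq_of_eqOn (le_antisymm h.1 h'.1) h.2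

theorem le_iff : z ≤ w ↔ z.len ≤ w.len ∧ Set.EqOn z.val w.val (Set.Iio z.len) := Iff.rfl

theorem lt_iff : z < w ↔ z.len < w.len ∧ Set.EqOn z.val w.val (Set.Iio z.len) := by
  rw [lt_iff_le_and_ne, le_iff]
  constructor
  · rintro ⟨⟨hlen, hval⟩, hne⟩
    exact ⟨hlen.lt_of_ne fun heq => hne (eq_of_eqOn heq hval), hval⟩
  · rintro ⟨hlen, hval⟩
    exact ⟨⟨hlen.le, hval⟩, fun heq => hlen.ne (congrArg len heq)⟩

/-- The restriction of `h` to the initial segment below `β`. -/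
def restrict (h : W → ℕ) (β : W) : InitSeq W where
  len := β
  val ξ := if ξ < β then h ξ else 0
  val_eq_zero _ hξ := if_neg hξ.not_gt

@[simp] theorem len_restrict : (restrict h β).len = β := rfl

theorem eqOn_restrict (h : W → ℕ) (β : W) : Set.EqOn (restrict h β).val h (Set.Iio β) :=
  fun _ hξ => if_pos hξ

theorem eq_restrict (hval : Set.EqOn z.val h (Set.Iio z.len)) : z = restrict h z.len :=
  eq_of_eqOn rfl (hval.trans (eqOn_restrict h _).symm)

theorem restrict_le_iff : restrict h β ≤ z ↔ β ≤ z.len ∧ Set.EqOn h z.val (Set.Iio β) :=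
  and_congr_right fun _ => ⟨(eqOn_restrict h β).symm.trans, (eqOn_restrict h β).trans⟩

theorem restrict_lt_iff : restrict h β < z ↔ β < z.len ∧ Set.EqOn h z.val (Set.Iio β) :=
  lt_iff.trans <|
    and_congr_right fun _ => ⟨(eqOn_restrict h β).symm.trans, (eqOn_restrict h β).trans⟩

theorem le_restrict_iff : z ≤ restrict h β ↔ z.len ≤ β ∧ Set.EqOn z.val h (Set.Iio z.len) := by
  refine and_congr_right fun hlen => ?_
  have hsub := (eqOn_restrict h β).mono (Set.Iio_subset_Iio hlen)
  exact ⟨fun hval => hval.trans hsub, fun hval => hval.trans hsub.symm⟩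

theorem lt_restrict_iff : z < restrict h β ↔ z.len < β ∧ Set.EqOn z.val h (Set.Iio z.len) := by
  rw [lt_iff, len_restrict]
  exact and_congr_right fun hlen =>
    ⟨fun hval => (le_restrict_iff.1 ⟨hlen.le, hval⟩).2,
      fun hval => (le_restrict_iff.2 ⟨hlen.le, hval⟩).2⟩

theorem restrict_congr (hh : Set.EqOn h h' (Set.Iio β)) : restrict h β = restrict h' β :=
  eq_of_eqOn rfl ((eqOn_restrict h β).trans (hh.trans (eqOn_restrict h' β).symm))

theorem eqOn_of_restrict_eq (heq : restrict h β = restrict h' β) : Set.EqOn h h' (Set.Iio β) :=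
  (heq ▸ eqOn_restrict h β).symm.trans (eqOn_restrict h' β)

theorem restrict_mono (h : W → ℕ) : Monotone (restrict h) := fun _ _ hβ =>
  restrict_le_iff.2 ⟨hβ, (eqOn_restrict h _).symm.mono (Set.Iio_subset_Iio hβ)⟩

/-- The place at which `w` leaves `z`, that is, the least `α < z.len` such that `w` does not extend
the restriction of `z` to `[0, α]`. -/
def BranchesOff (z w : InitSeq W) (α : W) : Prop :=
  α < z.len ∧ restrict z.val α ≤ w ∧ (α = w.len ∨ z.val α ≠ w.val α)

theorem BranchesOff.len_le (hα : BranchesOff z w α) : α ≤ w.len := hα.2.1.1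

theorem BranchesOff.eqOn (hα : BranchesOff z w α) : Set.EqOn z.val w.val (Set.Iio α) :=
  (restrict_le_iff.1 hα.2.1).2

theorem branchesOff_iff : BranchesOff z w α ↔
    α < z.len ∧ α ≤ w.len ∧ Set.EqOn z.val w.val (Set.Iio α) ∧ (α = w.len ∨ z.val α ≠ w.val α) := by
  rw [BranchesOff, restrict_le_iff, and_assoc]

theorem BranchesOff.unique (hα : BranchesOff z w α) (hβ : BranchesOff z w β) :
    α = β := by
  have key {α β : W} (hα : BranchesOff z w α) (hβ : BranchesOff z w β) : β ≤ α := by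
    by_contra! hlt
    exact hα.2.2.elim (hlt.trans_le hβ.len_le).ne fun hne => hne (hβ.eqOn hlt)
  exact le_antisymm (key hβ hα) (key hα hβ)

theorem not_branchesOff_of_le (hzw : z ≤ w) : ¬ BranchesOff z w α := fun hα =>
  hα.2.2.elim (hα.1.trans_le hzw.1).ne fun hne => hne (hzw.2 hα.1)

theorem branchesOff_of_lt (hzw : z < w) : BranchesOff w z z.len :=
  branchesOff_iff.2 ⟨(lt_iff.1 hzw).1, le_rfl, (lt_iff.1 hzw).2.symm, Or.inl rfl⟩

theorem le_or_exists_branchesOff [WellFoundedLT W] (z w : InitSeq W) :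
    z ≤ w ∨ ∃ α, BranchesOff z w α := by
  refine or_iff_not_imp_right.2 fun hnone => ?_
  have hbelow (ξ : W) (hξ : ξ < z.len) : ξ < w.len ∧ z.val ξ = w.val ξ := by
    induction ξ using WellFoundedLT.induction with
    | ind ξ ih =>
      have hle : ξ ≤ w.len := not_lt.1 fun hlt => (ih _ hlt (hlt.trans hξ)).1.false
      by_contra hξw
      refine hnone ⟨ξ, branchesOff_iff.2 ⟨hξ, hle, fun η hη => (ih η hη (hη.trans hξ)).2, ?_⟩⟩
      rw [not_and_or, not_lt] at hξw
      exact hξw.imp_left (le_antisymm hle)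
  exact ⟨not_lt.1 fun hlt => (hbelow _ hlt).1.false, fun ξ hξ => (hbelow ξ hξ).2⟩

theorem exists_forall_eq_restrict_of_isChain {C : Set (InitSeq W)} (hC : IsChain (· ≤ ·) C) :
    ∃ x : W → ℕ, ∀ t ∈ C, t = restrict x t.len := by
  have hval (ξ : W) : ∃ n, ∀ t ∈ C, ξ < t.len → t.val ξ = n := by
    by_cases h : ∃ t ∈ C, ξ < t.len
    · obtain ⟨t, ht, hξ⟩ := h
      exact ⟨t.val ξ, fun s hs hξs =>
        (hC.total hs ht).elim (fun hle => hle.2 hξs) fun hle => (hle.2 hξ).symm⟩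
    · exact ⟨0, fun t ht hξ => absurd ⟨t, ht, hξ⟩ h⟩
  choose x hx using hval
  exact ⟨x, fun t ht => eq_restrict fun ξ hξ => hx ξ t ht hξ⟩

theorem BranchesOff.le_of_restrict_le {x : W → ℕ}
    (hα : BranchesOff (restrict x γ) w α) (hw : restrict x β ≤ w) : β ≤ α := by
  by_contra! hlt
  rw [restrict_le_iff] at hw
  refine hα.2.2.elim (hlt.trans_le hw.1).ne fun hne => hne ?_
  exact (eqOn_restrict x γ hα.1).trans (hw.2 hlt)

theorem restrict_restrict {x : W → ℕ} (hα : α ≤ β) :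
    restrict (restrict x β).val α = restrict x α :=
  restrict_congr ((eqOn_restrict x β).mono (Set.Iio_subset_Iio hα))

theorem BranchesOff.restrict_of_le {x : W → ℕ}
    (hα : BranchesOff (restrict x β) w α) (hβ : β ≤ γ) : BranchesOff (restrict x γ) w α := by
  have hαγ : α < γ := hα.1.trans_le hβ
  have hxα : (restrict x β).val α = (restrict x γ).val α :=
    (eqOn_restrict x β hα.1).trans (eqOn_restrict x γ hαγ).symm
  refine ⟨hαγ, ?_, hxα ▸ hα.2.2⟩
  rw [restrict_restrict hαγ.le, ← restrict_restrict (le_of_lt hα.1)]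
  exact hα.2.1

end InitSeq

/-! ### The space of paths through a tree of sequences -/

open InitSeq

/-- The parameters that turn the paths through a tree of sequences into a topological space with
fibres in `Y`. A path `z` carries the fibre `Y` if its length has uncountable cofinality and only
the label `base` otherwise; the paths that branch off `z` at `α` accumulate, as `α` grows, at those
points of its fibre at which `anchor z.len` accumulates. -/
structure PathSpaceData (W Y : Type*) [LinearOrder W] where
  /-- The admissible paths among those whose length has countable cofinality. -/
  admissible : Set (InitSeq W)
  base : Y
  anchor : W → W → Y
  exists_bound_of_anchor_eq : ∀ l, HasUncountableCof l →
    ∀ y, ∃ b < l, ∀ α < l, anchor l α = y → α ≤ b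
  anchor_eq_of_mem_Ioc : ∀ l, ∀ μ < l, HasUncountableCof μ →
    ∃ η < μ, ∀ α ∈ Set.Ioc η μ, anchor l α = anchor l μ
  anchor_eq_base : ∀ l, ¬ HasUncountableCof l → ∀ α, anchor l α = base

/-- The space of labelled paths of limit length through `T`; paths whose length has countable
cofinality are required to be maximal and admissible. -/
@[ext]
structure PathSpace {W Y : Type*} [LinearOrder W] (T : LowerSet (InitSeq W))
    (D : PathSpaceData W Y) where
  seq : InitSeq W
  lab : Y
  isSuccLimit : Order.IsSuccLimit seq.len
  mem_of_lt : ∀ s < seq, s ∈ T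
  notMem : ¬ HasUncountableCof seq.len → seq ∉ T
  mem_admissible : ¬ HasUncountableCof seq.len → seq ∈ D.admissible
  lab_eq_base : ¬ HasUncountableCof seq.len → lab = D.base

namespace PathSpace

variable {W Y : Type*} [LinearOrder W] {T : LowerSet (InitSeq W)} {D : PathSpaceData W Y}
  {z : InitSeq W} {p q : PathSpace T D} {O O' : Set Y} {α η η' : W}

theorem exists_lt (p : PathSpace T D) : ∃ ξ, ξ < p.seq.len := not_isMin_iff.1 p.isSuccLimit.1

variable (T D) in
/-- The basic neighbourhood of the points `(z, y)`, `y ∈ O`, determined by `η < z.len`. -/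
def nbd (z : InitSeq W) (O : Set Y) (η : W) : Set (PathSpace T D) :=
  {p | p.seq = z ∧ p.lab ∈ O ∨ ∃ α > η, BranchesOff z p.seq α ∧ D.anchor z.len α ∈ O}

theorem nbd_mono (hO : O ⊆ O') (hη : η' ≤ η) : nbd T D z O η ⊆ nbd T D z O' η' :=
  fun _ => Or.imp (And.imp_right fun h => hO h)
    (Exists.imp fun _ h => ⟨hη.trans_lt h.1, h.2.1, hO h.2.2⟩)

theorem mem_nbd_self (hp : p.lab ∈ O) : p ∈ nbd T D p.seq O η := Or.inl ⟨rfl, hp⟩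

theorem mem_nbd_iff_of_seq_eq (hp : p.seq = z) : p ∈ nbd T D z O η ↔ p.lab ∈ O :=
  ⟨fun h => h.elim And.right fun ⟨_, _, hα, _⟩ => (not_branchesOff_of_le hp.ge hα).elim,
    fun h => Or.inl ⟨hp, h⟩⟩

theorem mem_nbd_iff_of_branchesOff (hp : BranchesOff z p.seq α) :
    p ∈ nbd T D z O η ↔ η < α ∧ D.anchor z.len α ∈ O :=
  ⟨fun h => h.elim (fun h => (not_branchesOff_of_le h.1.ge hp).elim)
    fun ⟨_, hη, hβ, hO⟩ => hp.unique hβ ▸ ⟨hη, hO⟩, fun h => Or.inr ⟨α, h.1, hp, h.2⟩⟩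

theorem notMem_nbd_of_lt (hp : z < p.seq) : p ∉ nbd T D z O η := fun h =>
  h.elim (fun h => hp.ne' h.1) fun ⟨_, _, hα, _⟩ => not_branchesOff_of_le hp.le hα

theorem lt_of_mem_nbd (hp : z < p.seq) (hq : q ∈ nbd T D p.seq O z.len) : z < q.seq := by
  obtain ⟨hq, -⟩ | ⟨α, hα, hq, -⟩ := hq
  · rwa [hq]
  · exact lt_iff.2 ⟨hα.trans_le hq.len_le,
      (lt_iff.1 hp).2.trans (hq.eqOn.mono (Set.Iio_subset_Iio (le_of_lt hα)))⟩

theorem exists_branchesOff_of_mem_nbd (hz : ∀ s < z, s ∈ T) (hp : BranchesOff z p.seq α) (η : W) :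
    ∃ η' < p.seq.len, ∀ q ∈ nbd T D p.seq Set.univ η', ∃ β ≤ α, (η < α → η < β) ∧
      BranchesOff z q.seq β ∧ D.anchor z.len β = D.anchor z.len α := by
  rcases hp.len_le.eq_or_lt with heq | hlt
  · have hpz : p.seq < z := lt_iff.2 ⟨heq ▸ hp.1, heq ▸ hp.eqOn.symm⟩
    have hcof : HasUncountableCof α := by
      by_contra hcof
      exact p.notMem (heq ▸ hcof) (hz _ hpz)
    obtain ⟨η₁, hη₁, hconst⟩ := D.anchor_eq_of_mem_Ioc _ α hp.1 hcof
    obtain ⟨η₂, hη₂, hle, hη⟩ : ∃ η₂ < α, η₁ ≤ η₂ ∧ (η < α → η ≤ η₂) := by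
      by_cases hη : η < α
      · exact ⟨max η₁ η, max_lt hη₁ hη, le_max_left _ _, fun _ => le_max_right _ _⟩
      · exact ⟨η₁, hη₁, le_rfl, fun h => absurd h hη⟩
    refine ⟨η₂, heq ▸ hη₂, ?_⟩
    rintro q (⟨hq, -⟩ | ⟨β, hβ, hq, -⟩)
    · exact ⟨α, le_rfl, id, by rwa [hq], rfl⟩
    · have hβα : β < α := heq ▸ hq.1
      refine ⟨β, hβα.le, fun h => (hη h).trans_lt hβ, branchesOff_iff.2 ⟨hβα.trans hp.1,
        hq.len_le, ?_, ?_⟩, hconst β ⟨hle.trans_lt hβ, hβα.le⟩⟩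
      · exact (hp.eqOn.mono (Set.Iio_subset_Iio hβα.le)).trans hq.eqOn
      · rw [hp.eqOn hβα]
        exact hq.2.2
  · refine ⟨α, hlt, ?_⟩
    rintro q (⟨hq, -⟩ | ⟨β, hβ, hq, -⟩)
    · exact ⟨α, le_rfl, id, by rwa [hq], rfl⟩
    · refine ⟨α, le_rfl, id, branchesOff_iff.2 ⟨hp.1, (le_of_lt hβ).trans hq.len_le, ?_,
        Or.inr ?_⟩, rfl⟩
      · exact hp.eqOn.trans (hq.eqOn.mono (Set.Iio_subset_Iio (le_of_lt hβ)))
      · rw [← hq.eqOn hβ]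
        exact hp.2.2.resolve_left hlt.ne

section Topology

variable [TopologicalSpace Y]

instance : TopologicalSpace (PathSpace T D) where
  IsOpen U := ∀ p ∈ U, ∃ O, IsOpen O ∧ p.lab ∈ O ∧ ∃ η < p.seq.len, nbd T D p.seq O η ⊆ U
  isOpen_univ p _ :=
    ⟨Set.univ, isOpen_univ, trivial, p.exists_lt.imp fun _ h => ⟨h, Set.subset_univ _⟩⟩
  isOpen_inter := by
    rintro U V hU hV p ⟨hpU, hpV⟩
    obtain ⟨O, hO, hp, η, hη, h⟩ := hU p hpU
    obtain ⟨O', hO', hp', η', hη', h'⟩ := hV p hpV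
    exact ⟨O ∩ O', hO.inter hO', ⟨hp, hp'⟩, max η η', max_lt hη hη', Set.subset_inter
      ((nbd_mono Set.inter_subset_left (le_max_left _ _)).trans h)
      ((nbd_mono Set.inter_subset_right (le_max_right _ _)).trans h')⟩
  isOpen_sUnion := by
    rintro 𝒰 h p ⟨U, hU, hp⟩
    obtain ⟨O, hO, hpO, η, hη, h'⟩ := h U hU p hp
    exact ⟨O, hO, hpO, η, hη, h'.trans (Set.subset_sUnion_of_mem hU)⟩

theorem isOpen_iff {U : Set (PathSpace T D)} : IsOpen U ↔
    ∀ p ∈ U, ∃ O, IsOpen O ∧ p.lab ∈ O ∧ ∃ η < p.seq.len, nbd T D p.seq O η ⊆ U := Iff.rfl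

theorem isOpen_nbd (hz : ∀ s < z, s ∈ T) (hO : IsOpen O) (hη : η < z.len) :
    IsOpen (nbd T D z O η) := by
  refine isOpen_iff.2 fun p hp => ?_
  obtain ⟨rfl, hpO⟩ | ⟨α, hα, hpα, hαO⟩ := hp
  · exact ⟨O, hO, hpO, η, hη, subset_rfl⟩
  · obtain ⟨η', hη', h⟩ := exists_branchesOff_of_mem_nbd hz hpα η
    refine ⟨Set.univ, isOpen_univ, trivial, η', hη', fun q hq => ?_⟩
    obtain ⟨β, -, hηβ, hqβ, hanchor⟩ := h q hq
    exact Or.inr ⟨β, hηβ hα, hqβ, hanchor ▸ hαO⟩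

theorem isOpen_nbd_seq (p : PathSpace T D) (hO : IsOpen O) (hη : η < p.seq.len) :
    IsOpen (nbd T D p.seq O η) :=
  isOpen_nbd p.mem_of_lt hO hη

theorem isClosed_nbd [WellFoundedLT W] (hz : ∀ s < z, s ∈ T) (hO : IsClosed O) (hη : η < z.len) :
    IsClosed (nbd T D z O η) := by
  refine ⟨isOpen_iff.2 fun q hq => ?_⟩
  rcases le_or_exists_branchesOff z q.seq with hle | ⟨α, hα⟩
  · rcases hle.eq_or_lt with rfl | hlt
    · refine ⟨Oᶜ, hO.isOpen_compl, fun h => hq (Or.inl ⟨rfl, h⟩), η, hη, ?_⟩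
      rintro r (⟨hr, hrO⟩ | ⟨α, -, hr, hαO⟩)
      · rwa [Set.mem_compl_iff, mem_nbd_iff_of_seq_eq hr]
      · rw [Set.mem_compl_iff, mem_nbd_iff_of_branchesOff hr]
        exact fun h => hαO h.2
    · exact ⟨Set.univ, isOpen_univ, trivial, z.len, (lt_iff.1 hlt).1,
        fun r hr => notMem_nbd_of_lt (lt_of_mem_nbd hlt hr)⟩
  · obtain ⟨η', hη', h⟩ := exists_branchesOff_of_mem_nbd hz hα η
    refine ⟨Set.univ, isOpen_univ, trivial, η', hη', fun r hr => ?_⟩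
    obtain ⟨β, hβα, -, hrβ, hanchor⟩ := h r hr
    rw [Set.mem_compl_iff, mem_nbd_iff_of_branchesOff hα] at hq
    rw [Set.mem_compl_iff, mem_nbd_iff_of_branchesOff hrβ, hanchor]
    exact fun hβ => hq ⟨hβ.1.trans_le hβα, hβ.2⟩

instance [WellFoundedLT W] [RegularSpace Y] : RegularSpace (PathSpace T D) :=
  .of_exists_mem_nhds_isClosed_subset fun p s hs => by
    obtain ⟨U, hUs, hU, hp⟩ := mem_nhds_iff.1 hs
    obtain ⟨O, hO, hpO, η, hη, hOU⟩ := isOpen_iff.1 hU p hp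
    obtain ⟨V, hV, hVc, hVO⟩ := exists_mem_nhds_isClosed_subset (hO.mem_nhds hpO)
    obtain ⟨V', hV'V, hV', hpV'⟩ := mem_nhds_iff.1 hV
    exact ⟨nbd T D p.seq V η, Filter.mem_of_superset
      ((isOpen_nbd_seq p hV' hη).mem_nhds (mem_nbd_self hpV')) (nbd_mono hV'V le_rfl),
      isClosed_nbd p.mem_of_lt hVc hη, ((nbd_mono hVO le_rfl).trans hOU).trans hUs⟩

section

variable {Y' : Type*} [TopologicalSpace Y'] {D' : PathSpaceData W Y'}

theorem exists_isOpen_forall_seq_ne_of_branchesOff {p : PathSpace T D} {q : PathSpace T D'}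
    (hα : BranchesOff p.seq q.seq α) :
    ∃ (U : Set (PathSpace T D)) (V : Set (PathSpace T D')), IsOpen U ∧ IsOpen V ∧ p ∈ U ∧ q ∈ V ∧
      ∀ p' ∈ U, ∀ q' ∈ V, p'.seq ≠ q'.seq := by
  obtain ⟨η, hη, hV⟩ := exists_branchesOff_of_mem_nbd p.mem_of_lt hα α
  refine ⟨_, _, isOpen_nbd_seq p isOpen_univ hα.1, isOpen_nbd_seq q isOpen_univ hη,
    mem_nbd_self (Set.mem_univ _), mem_nbd_self trivial, fun p' hp' q' hq' heq => ?_⟩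
  obtain ⟨β, hβα, -, hβ, -⟩ := hV q' hq'
  exact ((mem_nbd_iff_of_branchesOff (heq ▸ hβ)).1 hp').1.not_ge hβα

theorem exists_isOpen_forall_seq_ne [WellFoundedLT W] {p : PathSpace T D} {q : PathSpace T D'}
    (hne : p.seq ≠ q.seq) :
    ∃ (U : Set (PathSpace T D)) (V : Set (PathSpace T D')), IsOpen U ∧ IsOpen V ∧ p ∈ U ∧ q ∈ V ∧
      ∀ p' ∈ U, ∀ q' ∈ V, p'.seq ≠ q'.seq := by
  rcases le_or_exists_branchesOff p.seq q.seq with hle | ⟨α, hα⟩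
  · obtain ⟨V, U, hV, hU, hq, hp, h⟩ :=
      exists_isOpen_forall_seq_ne_of_branchesOff (branchesOff_of_lt (hle.lt_of_ne hne))
    exact ⟨U, V, hU, hV, hp, hq, fun p' hp' q' hq' => (h q' hq' p' hp').symm⟩
  · exact exists_isOpen_forall_seq_ne_of_branchesOff hα

end

instance [WellFoundedLT W] [T1Space Y] : T1Space (PathSpace T D) := by
  refine ⟨fun p => ⟨isOpen_iff.2 fun q hq => ?_⟩⟩
  by_cases hseq : q.seq = p.seq
  · obtain ⟨η, hη⟩ := q.exists_lt
    refine ⟨{p.lab}ᶜ, isOpen_compl_singleton, fun h => hq (PathSpace.ext hseq h), η, hη, ?_⟩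
    rintro _ hp rfl
    exact (mem_nbd_iff_of_seq_eq hseq.symm).1 hp rfl
  · obtain ⟨U, V, hU, -, hqU, hpV, h⟩ := exists_isOpen_forall_seq_ne hseq
    obtain ⟨O, hO, hqO, η, hη, hsub⟩ := isOpen_iff.1 hU q hqU
    exact ⟨O, hO, hqO, η, hη, fun r hr hrp => h r (hsub hr) p hpV (congrArg seq hrp)⟩

theorem isGδ_singleton_of_hasUncountableCof (hY : ∀ y : Y, IsGδ {y})
    (hp : HasUncountableCof p.seq.len) : IsGδ {p} := by
  obtain ⟨O, hO, hpO⟩ := isGδ_iff_eq_iInter_nat.1 (hY p.lab)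
  obtain ⟨b, hb, hbound⟩ := D.exists_bound_of_anchor_eq _ hp p.lab
  have hmem (y : Y) : y = p.lab ↔ ∀ n, y ∈ O n := by
    rw [← Set.mem_singleton_iff, hpO, Set.mem_iInter]
  suffices {p} = ⋂ n, nbd T D p.seq (O n) b from
    this ▸ .iInter_of_isOpen fun n => isOpen_nbd_seq p (hO n) hb
  refine (Set.singleton_subset_iff.2 <| Set.mem_iInter.2 fun n =>
    mem_nbd_self ((hmem _).1 rfl n)).antisymm fun q hq => ?_
  rw [Set.mem_iInter] at hq
  rcases hq 0 with ⟨hseq, -⟩ | ⟨α, hα, hqα, -⟩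
  · simp only [mem_nbd_iff_of_seq_eq hseq] at hq
    exact PathSpace.ext hseq ((hmem _).2 hq)
  · simp only [mem_nbd_iff_of_branchesOff hqα] at hq
    exact absurd (hbound α hqα.1 ((hmem _).2 fun n => (hq n).2)) (not_le.2 hα)

theorem isGδ_singleton_of_not_hasUncountableCof (hp : ¬ HasUncountableCof p.seq.len) :
    IsGδ {p} := by
  obtain ⟨s, hsp, hs, hcof⟩ := exists_countable_of_not_hasUncountableCof hp
  suffices {p} = ⋂ η ∈ s, nbd T D p.seq Set.univ η from
    this ▸ .biInter_of_isOpen hs fun η hη => isOpen_nbd_seq p isOpen_univ (hsp hη)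
  refine (Set.singleton_subset_iff.2 <| Set.mem_iInter₂.2 fun η _ =>
    mem_nbd_self (Set.mem_univ _)).antisymm fun q hq => ?_
  rw [Set.mem_iInter₂] at hq
  have hseq : q.seq = p.seq := by
    obtain ⟨ξ, hξ⟩ := p.exists_lt
    obtain ⟨η, hη, -⟩ := hcof ξ hξ
    refine (hq η hη).elim And.left fun ⟨α, _, hα, _⟩ => ?_
    obtain ⟨η', hη', hle⟩ := hcof α hα.1
    exact absurd ((mem_nbd_iff_of_branchesOff hα).1 (hq η' hη')).1 hle.not_gt
  exact PathSpace.ext hseq ((q.lab_eq_base (hseq ▸ hp)).trans (p.lab_eq_base hp).symm)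

theorem isGδ_singleton (hY : ∀ y : Y, IsGδ {y}) (p : PathSpace T D) : IsGδ {p} := by
  by_cases hp : HasUncountableCof p.seq.len
  · exact isGδ_singleton_of_hasUncountableCof hY hp
  · exact isGδ_singleton_of_not_hasUncountableCof hp

end Topology

end PathSpace

/-! ### Countably covered sets of paths -/

/-- `A` is covered by countably many members of the family `U`. -/
def CountablyCovered {X ι : Type*} (U : ι → Set X) (A : Set X) : Prop :=
  ∃ t : Set ι, t.Countable ∧ A ⊆ ⋃ i ∈ t, U i

namespace CountablyCovered

variable {X ι : Type*} {U : ι → Set X} {A B : Set X}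

theorem mono (hB : CountablyCovered U B) (hAB : A ⊆ B) : CountablyCovered U A :=
  hB.imp fun _ ht => ⟨ht.1, hAB.trans ht.2⟩

theorem of_subset {i : ι} (hA : A ⊆ U i) : CountablyCovered U A :=
  ⟨{i}, Set.countable_singleton i, by simpa using hA⟩

theorem empty : CountablyCovered U ∅ := ⟨∅, Set.countable_empty, Set.empty_subset _⟩

theorem biUnion {κ : Type*} {s : Set κ} (hs : s.Countable) {A : κ → Set X}
    (hA : ∀ k ∈ s, CountablyCovered U (A k)) : CountablyCovered U (⋃ k ∈ s, A k) := by
  choose! t ht hAt using hA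
  refine ⟨⋃ k ∈ s, t k, hs.biUnion ht, Set.iUnion₂_subset fun k hk => (hAt k hk).trans ?_⟩
  exact Set.biUnion_subset_biUnion_left (Set.subset_biUnion_of_mem (u := t) hk)

theorem union (hA : CountablyCovered U A) (hB : CountablyCovered U B) :
    CountablyCovered U (A ∪ B) := by
  obtain ⟨s, hs, hAs⟩ := hA
  obtain ⟨t, ht, hBt⟩ := hB
  refine ⟨s ∪ t, hs.union ht, ?_⟩
  rw [Set.biUnion_union]
  exact Set.union_subset_union hAs hBt

end CountablyCovered

namespace PathSpace

variable {W Y : Type*} [LinearOrder W] {T : LowerSet (InitSeq W)} {D : PathSpaceData W Y}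
  {s t z : InitSeq W}

variable (T D) in
/-- The points whose path extends `s`. -/
def cone (s : InitSeq W) : Set (PathSpace T D) := {p | s ≤ p.seq}

variable [TopologicalSpace Y] [LindelofSpace Y] {ι : Type*} {U : ι → Set (PathSpace T D)}

theorem exists_countablyCovered_near (hU : ∀ i, IsOpen (U i)) (hcov : ∀ p, ∃ i, p ∈ U i)
    (hz : ∀ s < z, s ∈ T) (hcof : HasUncountableCof z.len) :
    ∃ η < z.len, CountablyCovered U {p | p.seq = z ∨ ∃ α > η, BranchesOff z p.seq α} := by
  have hnbd (y : Y) : ∃ i, ∃ O, IsOpen O ∧ y ∈ O ∧ ∃ η < z.len, nbd T D z O η ⊆ U i := by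
    obtain ⟨i, hi⟩ := hcov ⟨z, y, hcof.isSuccLimit, hz, absurd hcof, absurd hcof, absurd hcof⟩
    exact ⟨i, isOpen_iff.1 (hU i) _ hi⟩
  choose i O hO hyO e he hsub using hnbd
  obtain ⟨t, ht, htO⟩ := isLindelof_univ.elim_countable_subcover O hO
    fun y _ => Set.mem_iUnion.2 ⟨y, hyO y⟩
  obtain ⟨η, hη, hlt⟩ := hcof.exists_forall_lt (s := e '' t)
    (Set.image_subset_iff.2 fun y _ => he y) (ht.image e)
  refine ⟨η, hη, i '' t, ht.image i, ?_⟩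
  rw [Set.biUnion_image]
  rintro p (hp | ⟨α, hα, hp⟩)
  · obtain ⟨y, hy, hpy⟩ := Set.mem_iUnion₂.1 (htO (Set.mem_univ p.lab))
    exact Set.mem_iUnion₂.2 ⟨y, hy, hsub y (Or.inl ⟨hp, hpy⟩)⟩
  · obtain ⟨y, hy, hpy⟩ := Set.mem_iUnion₂.1 (htO (Set.mem_univ (D.anchor z.len α)))
    exact Set.mem_iUnion₂.2
      ⟨y, hy, hsub y (Or.inr ⟨α, (hlt _ (Set.mem_image_of_mem e hy)).trans hα, hp, hpy⟩)⟩

theorem countablyCovered_fiber (hU : ∀ i, IsOpen (U i)) (hcov : ∀ p, ∃ i, p ∈ U i)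
    (z : InitSeq W) : CountablyCovered U {p | p.seq = z} := by
  rcases Set.eq_empty_or_nonempty {p : PathSpace T D | p.seq = z} with hemp | ⟨p, rfl⟩
  · exact hemp ▸ CountablyCovered.empty
  by_cases hcof : HasUncountableCof p.seq.len
  · obtain ⟨η, -, h⟩ := exists_countablyCovered_near hU hcov p.mem_of_lt hcof
    exact h.mono fun q hq => Or.inl hq
  · obtain ⟨i, hi⟩ := hcov p
    refine .of_subset (i := i) fun q (hq : q.seq = p.seq) => ?_
    rwa [PathSpace.ext hq ((q.lab_eq_base (hq ▸ hcof)).trans (p.lab_eq_base hcof).symm)]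

theorem mem_of_not_countablyCovered_cone (hU : ∀ i, IsOpen (U i)) (hcov : ∀ p, ∃ i, p ∈ U i)
    (hs : ¬ CountablyCovered U (cone T D s)) : s ∈ T := by
  by_contra hsT
  refine hs ((countablyCovered_fiber hU hcov s).mono fun p (hp : s ≤ p.seq) => ?_)
  exact (hp.eq_or_lt.resolve_right fun hlt => hsT (p.mem_of_lt s hlt)).symm

variable [WellFoundedLT W]

theorem countablyCovered_diff_cone (hU : ∀ i, IsOpen (U i)) (hcov : ∀ p, ∃ i, p ∈ U i)
    {A : Set (PathSpace T D)} {x : W → ℕ} (γ : W) (hx : ∀ s < restrict x γ, s ∈ T)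
    (hA : ∀ α < γ, CountablyCovered U (A ∩ {p | BranchesOff (restrict x γ) p.seq α})) :
    CountablyCovered U (A \ cone T D (restrict x γ)) := by
  induction γ using WellFoundedLT.induction with
  | ind γ ih =>
    have hbelow (η : W) (hη : η < γ) : CountablyCovered U ((A \ cone T D (restrict x η)) ∪
        A ∩ {p | BranchesOff (restrict x γ) p.seq η}) := by
      refine (ih η hη (fun s hs => hx s (hs.trans_le (restrict_mono x hη.le))) fun α hα => ?_).union
        (hA η hη)
      exact (hA α (hα.trans hη)).mono <|
        Set.inter_subset_inter_right A fun p hp => hp.restrict_of_le hη.le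
    have hbranch {p : PathSpace T D} {α η : W} (hpA : p ∈ A)
        (hp : BranchesOff (restrict x γ) p.seq α) (hη : α ≤ η) :
        p ∈ (A \ cone T D (restrict x η)) ∪ A ∩ {p | BranchesOff (restrict x γ) p.seq η} := by
      by_cases hpη : p ∈ cone T D (restrict x η)
      · exact Or.inr ⟨hpA, le_antisymm hη (hp.le_of_restrict_le hpη) ▸ hp⟩
      · exact Or.inl ⟨hpA, hpη⟩
    by_cases hcof : HasUncountableCof γ
    · obtain ⟨η, hη, hnear⟩ := exists_countablyCovered_near hU hcov hx hcof
      refine ((hbelow η hη).union hnear).mono fun p ⟨hpA, hp⟩ => ?_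
      obtain ⟨α, hα⟩ := (le_or_exists_branchesOff _ _).resolve_left hp
      exact (le_or_gt α η).imp (hbranch hpA hα) fun hlt => Or.inr ⟨α, hlt, hα⟩
    · obtain ⟨S, hSγ, hS, hScof⟩ := exists_countable_of_not_hasUncountableCof hcof
      refine (CountablyCovered.biUnion hS fun η hη => hbelow η (hSγ hη)).mono fun p ⟨hpA, hp⟩ => ?_
      obtain ⟨α, hα⟩ := (le_or_exists_branchesOff _ _).resolve_left hp
      obtain ⟨η, hη, hle⟩ := hScof α hα.1
      exact Set.mem_iUnion₂.2 ⟨η, hη, hbranch hpA hα hle⟩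

theorem countablyCovered_branchesOff (hU : ∀ i, IsOpen (U i)) (hcov : ∀ p, ∃ i, p ∈ U i) (α : W)
    (hz : ∀ t, restrict z.val α < t → ¬ t ≤ z → CountablyCovered U (cone T D t)) :
    CountablyCovered U {p | BranchesOff z p.seq α} := by
  by_cases hα : α < z.len
  · obtain ⟨β, hαβ⟩ := exists_covBy_of_wellFoundedLT (not_isMax_iff.2 ⟨_, hα⟩)
    let t (n : ℕ) : InitSeq W := restrict (Function.update z.val α n) β
    have ht (n : ℕ) (hn : n ∈ {n | n ≠ z.val α}) : CountablyCovered U (cone T D (t n)) := by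
      refine hz _ (restrict_lt_iff.2 ⟨hαβ.1, fun ξ (hξ : ξ < α) => ?_⟩) fun hle => hn ?_
      · rw [eqOn_restrict _ β (hξ.trans hαβ.1), Function.update_of_ne hξ.ne]
      · rw [← (restrict_le_iff.1 hle).2 hαβ.1, Function.update_self]
    refine ((countablyCovered_fiber hU hcov (restrict z.val α)).union
      (.biUnion (Set.to_countable _) ht)).mono fun p hp => ?_
    rcases hp.2.1.eq_or_lt with heq | hlt
    · exact Or.inl heq.symm
    · rw [restrict_lt_iff] at hlt
      refine Or.inr (Set.mem_iUnion₂.2 ⟨p.seq.val α, (hp.2.2.resolve_left hlt.1.ne).symm,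
        restrict_le_iff.2 ⟨hαβ.ge_of_gt hlt.1, fun ξ hξ => ?_⟩⟩)
      rcases (hαβ.le_of_lt hξ).eq_or_lt with rfl | hξα
      · exact Function.update_self ..
      · rw [Function.update_of_ne hξα.ne, hlt.2 hξα]
  · exact CountablyCovered.empty.mono fun p hp => hα hp.1

theorem countablyCovered_cone_of_forall_lt (hU : ∀ i, IsOpen (U i)) (hcov : ∀ p, ∃ i, p ∈ U i)
    {x : W → ℕ} {γ : W} (hx : ∀ t < restrict x γ, t ∈ T)
    (hs : ∀ t, s ≤ t → ¬ CountablyCovered U (cone T D t) → t < restrict x γ) :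
    CountablyCovered U (cone T D s) := by
  by_contra hbad
  have hsz : s < restrict x γ := hs s le_rfl hbad
  have hsx : s = restrict x s.len := eq_restrict (lt_restrict_iff.1 hsz).2
  have hcone : CountablyCovered U (cone T D (restrict x γ)) := by
    by_contra hz
    exact (hs _ hsz.le hz).false
  refine hbad (((countablyCovered_diff_cone hU hcov γ hx fun α hα => ?_).union hcone).mono
    (Set.subset_sdiff_union _ _))
  rcases lt_or_ge α s.len with hlt | hle
  · refine CountablyCovered.empty.mono fun p ⟨hps, hp⟩ => ?_
    rw [hsx] at hps
    exact (hp.le_of_restrict_le hps).not_gt hlt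
  · refine (countablyCovered_branchesOff hU hcov α fun t ht htz => ?_).mono Set.inter_subset_right
    by_contra ht'
    rw [restrict_restrict hα.le] at ht
    exact htz (hs t ((hsx.le.trans (restrict_mono x hle)).trans ht.le) ht').le

theorem not_isChain_not_countablyCovered (hU : ∀ i, IsOpen (U i))
    (hcov : ∀ p, ∃ i, p ∈ U i) (hT : ∀ x : W → ℕ, ∃ β, restrict x β ∉ T)
    (hs : ¬ CountablyCovered U (cone T D s)) :
    ¬ IsChain (· ≤ ·) {t | ¬ CountablyCovered U (cone T D t) ∧ s ≤ t} := by
  intro hC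
  set C := {t | ¬ CountablyCovered U (cone T D t) ∧ s ≤ t}
  obtain ⟨x, hx⟩ := exists_forall_eq_restrict_of_isChain hC
  have hmem {β : W} {t : InitSeq W} (ht : t ∈ C) (hβ : β ≤ t.len) : restrict x β ∈ T := by
    refine T.lower (?_ : restrict x β ≤ t) (mem_of_not_countablyCovered_cone hU hcov ht.1)
    rw [hx t ht]
    exact restrict_mono x hβ
  obtain ⟨β, hβ⟩ := hT x
  have hbound : {γ | ∀ t ∈ C, t.len < γ}.Nonempty :=
    ⟨β, fun t ht => not_le.1 fun hle => hβ (hmem ht hle)⟩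
  set γ := wellFounded_lt.min _ hbound
  have hγ : ∀ t ∈ C, t.len < γ := wellFounded_lt.min_mem _ hbound
  refine hs (countablyCovered_cone_of_forall_lt (x := x) (γ := γ) hU hcov (fun t ht => ?_)
    fun t hst ht => ?_)
  · rw [lt_restrict_iff] at ht
    obtain ⟨t', ht', hle⟩ : ∃ t' ∈ C, t.len ≤ t'.len := by
      by_contra! h
      exact (wellFounded_lt.min_le (show t.len ∈ {γ | ∀ t ∈ C, t.len < γ} from h)).not_gt ht.1
    exact eq_restrict ht.2 ▸ hmem ht' hle
  · rw [hx t ⟨ht, hst⟩]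
    exact (restrict_mono x (hγ t ⟨ht, hst⟩).le).lt_of_ne fun heq =>
      (hγ t ⟨ht, hst⟩).ne (congrArg len heq)

end PathSpace

/-! ### Perfect trees of nodes -/

theorem exists_countable_subset_not_isChain {α : Type*} [Preorder α] {Q : Set α} (hne : Q.Nonempty)
    (hQ : ∀ q ∈ Q, ¬ IsChain (· ≤ ·) {t ∈ Q | q ≤ t}) :
    ∃ M ⊆ Q, M.Countable ∧ M.Nonempty ∧ ∀ q ∈ M, ¬ IsChain (· ≤ ·) {t ∈ M | q ≤ t} := by
  have hchild (q : Q) :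
      ∃ c : Bool → Q, (∀ b, q ≤ c b) ∧ ¬ c true ≤ c false ∧ ¬ c false ≤ c true := by
    have hq := hQ q q.2
    simp only [IsChain, Set.Pairwise, not_forall, not_or] at hq
    obtain ⟨t, ht, t', ht', -, h, h'⟩ := hq
    exact ⟨fun b => cond b ⟨t, ht.1⟩ ⟨t', ht'.1⟩, Bool.forall_bool.2 ⟨ht'.2, ht.2⟩, h, h'⟩
  choose c hle hc hc' using hchild
  obtain ⟨q₀, hq₀⟩ := hne
  let node (l : List Bool) : Q := l.foldr (fun b q => c q b) ⟨q₀, hq₀⟩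
  refine ⟨Set.range fun l => (node l : α), Set.range_subset_iff.2 fun l => (node l).2,
    Set.countable_range _, Set.range_nonempty _, ?_⟩
  rintro _ ⟨l, rfl⟩ hchain
  have hmem (b : Bool) : (c (node l) b : α) ∈ {t ∈ Set.range fun l => (node l : α) | node l ≤ t} :=
    ⟨⟨b :: l, rfl⟩, hle _ b⟩
  exact (hchain.total (hmem true) (hmem false)).elim (hc _) (hc' _)

namespace InitSeq

variable {W : Type*} [LinearOrder W]

/-- Every node of `T` of length `δ` coincides on a final segment of `δ` with one of countably many
functions. -/
def IsThin (T : LowerSet (InitSeq W)) : Prop :=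
  ∀ δ, ¬ IsMin δ → ∃ G : Set (W → ℕ), G.Countable ∧
    ∀ z ∈ T, z.len = δ → ∃ f ∈ G, ∃ η < δ, Set.EqOn z.val f (Set.Ico η δ)

/-- The maximal paths of length `δ` through `T` that are approximated by nodes in `M`. -/
def limitPaths (T : LowerSet (InitSeq W)) (δ : W) (M : Set (InitSeq W)) : Set (InitSeq W) :=
  {z | z.len = δ ∧ (∀ s < z, s ∈ T) ∧ z ∉ T ∧ ∀ η < δ, ∃ q ∈ M, η ≤ q.len ∧ q < z}

/-- `P` meets all uncountable sets of limit paths of countable sets of nodes. -/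
def MeetsLimitPaths (T : LowerSet (InitSeq W)) (P : Set (InitSeq W)) : Prop :=
  ∀ δ, ∀ M ⊆ {q | q ∈ T ∧ q.len < δ}, M.Countable → ¬ (limitPaths T δ M).Countable →
    (limitPaths T δ M ∩ P).Nonempty

/-- A tree of nodes below height `δ` in which each node has incomparable extensions and extensions
of lengths cofinal in `δ`. -/
structure IsPerfectTree (δ : W) (M : Set (InitSeq W)) : Prop where
  nonempty : M.Nonempty
  len_lt : ∀ q ∈ M, q.len < δ
  not_isChain : ∀ q ∈ M, ¬ IsChain (· ≤ ·) {t ∈ M | q ≤ t}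
  exists_le : ∀ q ∈ M, ∀ ε < δ, ∃ t ∈ M, q ≤ t ∧ ε ≤ t.len

variable {δ : W} {M : Set (InitSeq W)}

theorem exists_isPerfectTree [WellFoundedLT W] (hne : M.Nonempty) (hbound : ∃ w, ∀ q ∈ M, q.len < w)
    (hM : ∀ q ∈ M, ¬ IsChain (· ≤ ·) {t ∈ M | q ≤ t}) :
    ∃ δ, ∃ M' ⊆ M, IsPerfectTree δ M' := by
  -- Above a node for which the supremum of the lengths of its extensions is least, this supremum is
  -- the same for all nodes.
  let B := {w | ∃ q ∈ M, ∀ t ∈ M, q ≤ t → t.len < w}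
  have hB : B.Nonempty := by
    obtain ⟨w, hw⟩ := hbound
    obtain ⟨q, hq⟩ := hne
    exact ⟨w, q, hq, fun t ht _ => hw t ht⟩
  obtain ⟨q₀, hq₀, hlen⟩ : wellFounded_lt.min B hB ∈ B := wellFounded_lt.min_mem _ hB
  refine ⟨wellFounded_lt.min B hB, {t ∈ M | q₀ ≤ t}, Set.sep_subset _ _,
    ⟨q₀, hq₀, le_rfl⟩, fun q hq => hlen q hq.1 hq.2, fun q hq hchain => ?_, fun q hq ε hε => ?_⟩
  · have hsub : {t ∈ M | q ≤ t} ⊆ {t ∈ {t ∈ M | q₀ ≤ t} | q ≤ t} :=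
      fun t ht => ⟨⟨ht.1, hq.2.trans ht.2⟩, ht.2⟩
    exact hM q hq.1 (hchain.mono hsub)
  · by_contra! h
    have hεB : ε ∈ B := ⟨q, hq.1, fun t ht hqt => h t ⟨ht, hq.2.trans hqt⟩ hqt⟩
    exact (wellFounded_lt.min_le hεB).not_gt hε

namespace IsPerfectTree

theorem exists_le_val_ne (hM : IsPerfectTree δ M) {q : InitSeq W} (hq : q ∈ M) {ε : W} (hε : ε < δ)
    (f : W → ℕ) : ∃ t ∈ M, q ≤ t ∧ ∃ ξ, ε ≤ ξ ∧ ξ < t.len ∧ t.val ξ ≠ f ξ := by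
  obtain ⟨a, ha, hqa, hεa⟩ := hM.exists_le q hq ε hε
  by_contra! h
  have hle {t t' : InitSeq W} (ht : t ∈ {t ∈ M | a ≤ t}) (ht' : t' ∈ {t ∈ M | a ≤ t})
      (hlen : t.len ≤ t'.len) : t ≤ t' := by
    refine ⟨hlen, fun ξ hξ => ?_⟩
    rcases lt_or_ge ξ a.len with hlt | hge
    · exact (ht.2.2 hlt).symm.trans (ht'.2.2 hlt)
    · exact (h t ht.1 (hqa.trans ht.2) ξ (hεa.trans hge) hξ).trans
        (h t' ht'.1 (hqa.trans ht'.2) ξ (hεa.trans hge) (hξ.trans_le hlen)).symm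
  exact hM.not_isChain a ha fun t ht t' ht' _ =>
    (le_total t.len t'.len).imp (hle ht ht') (hle ht' ht)

theorem isSuccLimit (hM : IsPerfectTree δ M) : Order.IsSuccLimit δ := by
  obtain ⟨q, hq⟩ := hM.nonempty
  refine ⟨not_isMin_iff.2 ⟨_, hM.len_lt q hq⟩, fun ε hε => ?_⟩
  obtain ⟨t, ht, -, ξ, hεξ, hξ, -⟩ := hM.exists_le_val_ne hq hε.1 0
  exact hε.2 (hεξ.trans_lt hξ) (hM.len_lt t ht)

theorem not_hasUncountableCof (hM : IsPerfectTree δ M) (hcount : M.Countable) :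
    ¬ HasUncountableCof δ := by
  intro hδ
  obtain ⟨η, hη, hlt⟩ := hδ.exists_forall_lt (Set.image_subset_iff.2 hM.len_lt) (hcount.image len)
  obtain ⟨q, hq⟩ := hM.nonempty
  obtain ⟨t, ht, -, hle⟩ := hM.exists_le q hq η hη
  exact (hlt _ (Set.mem_image_of_mem len ht)).not_ge hle

theorem exists_path (hM : IsPerfectTree δ M) (hcount : M.Countable) {F : Set (W → ℕ)}
    (hF : F.Countable) :
    ∃ z : InitSeq W, z.len = δ ∧ (∀ η < δ, ∃ q ∈ M, η ≤ q.len ∧ q < z) ∧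
      ∀ f ∈ F, ∀ η < δ, ¬ Set.EqOn z.val f (Set.Ico η δ) := by
  obtain ⟨q₀, hq₀⟩ := hM.nonempty
  obtain ⟨e, he⟩ := ((hF.insert 0).prod hcount).exists_eq_range ⟨(0, q₀), Set.mem_insert _ _, hq₀⟩
  have heM (n : ℕ) : (e n).2 ∈ M := (he ▸ Set.mem_range_self n : e n ∈ _ ×ˢ M).2
  have hnext (q : M) (n : ℕ) : ∃ t : M, q ≤ t ∧ ∃ ξ, (e n).2.len ≤ ξ ∧ ξ < t.1.len ∧
      t.1.val ξ ≠ (e n).1 ξ := by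
    obtain ⟨t, ht, h⟩ := hM.exists_le_val_ne q.2 (hM.len_lt _ (heM n)) (e n).1
    exact ⟨⟨t, ht⟩, h⟩
  choose next hle hne using hnext
  let a (n : ℕ) : M := n.rec ⟨q₀, hq₀⟩ fun n q => next q n
  have ha : Monotone fun n => (a n).1 := monotone_nat_of_le_succ fun n => hle (a n) n
  obtain ⟨x, hx⟩ := exists_forall_eq_restrict_of_isChain ha.isChain_range
  have hlt (n : ℕ) : (a n).1 < restrict x δ := by
    have hlen : (a n).1.len < δ := hM.len_lt _ (a n).2
    exact (hx _ ⟨n, rfl⟩).trans_lt ((restrict_mono x hlen.le).lt_of_ne (ne_of_apply_ne len hlen.ne))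
  have hdiag {f : W → ℕ} (hf : f ∈ insert 0 F) {η : W} (hη : η < δ) :
      ∃ n, ∃ ξ, η ≤ ξ ∧ ξ < (a n).1.len ∧ (restrict x δ).val ξ ≠ f ξ := by
    obtain ⟨q, hq, -, hηq⟩ := hM.exists_le q₀ hq₀ η hη
    obtain ⟨n, hn⟩ : (f, q) ∈ Set.range e := he ▸ ⟨hf, hq⟩
    obtain ⟨ξ, hξ, hξa, hξf⟩ := hne (a n) n
    rw [hn] at hξ hξf
    exact ⟨n + 1, ξ, hηq.trans hξ, hξa, (lt_iff.1 (hlt (n + 1))).2 hξa ▸ hξf⟩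
  refine ⟨restrict x δ, rfl, fun η hη => ?_, fun f hf η hη heq => ?_⟩
  · obtain ⟨n, ξ, hηξ, hξ, -⟩ := hdiag (Set.mem_insert 0 F) hη
    exact ⟨_, (a n).2, hηξ.trans (le_of_lt hξ), hlt n⟩
  · obtain ⟨n, ξ, hηξ, hξ, hξf⟩ := hdiag (Set.mem_insert_of_mem 0 hf) hη
    exact hξf (heq ⟨hηξ, hξ.trans (hM.len_lt _ (a n).2)⟩)

theorem not_countable_limitPaths (hM : IsPerfectTree δ M) (hcount : M.Countable)
    {T : LowerSet (InitSeq W)} (hT : IsThin T) (hMT : M ⊆ T) : ¬ (limitPaths T δ M).Countable := by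
  intro hpaths
  obtain ⟨G, hG, hGT⟩ := hT δ hM.isSuccLimit.1
  obtain ⟨z, hz, hzM, hzF⟩ := hM.exists_path hcount (hG.union (hpaths.image val))
  have hzlim : z ∈ limitPaths T δ M := by
    refine ⟨hz, fun s hs => ?_, fun hzT => ?_, hzM⟩
    · obtain ⟨q, hq, hle, hqz⟩ := hzM s.len (hz ▸ (lt_iff.1 hs).1)
      exact T.lower ⟨hle, fun ξ hξ => ((lt_iff.1 hs).2 hξ).trans
        ((lt_iff.1 hqz).2 (hξ.trans_le hle)).symm⟩ (hMT hq)
    · obtain ⟨f, hf, η, hη, heq⟩ := hGT z hzT hz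
      exact hzF f (Or.inl hf) η hη heq
  obtain ⟨ξ, hξ⟩ := not_isMin_iff.1 hM.isSuccLimit.1
  exact hzF z.val (Or.inr ⟨z, hzlim, rfl⟩) ξ hξ (Set.eqOn_refl _ _)

end IsPerfectTree

end InitSeq

namespace PathSpace

variable {W Y : Type*} [LinearOrder W] [WellFoundedLT W] {T : LowerSet (InitSeq W)}
  {D : PathSpaceData W Y} [TopologicalSpace Y]

theorem exists_cone_subset_of_isOpen {p : PathSpace T D} (hp : ¬ HasUncountableCof p.seq.len)
    {V : Set (PathSpace T D)} (hV : IsOpen V) (hpV : p ∈ V) :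
    ∃ η < p.seq.len, ∀ q < p.seq, η < q.len → cone T D q ⊆ V := by
  obtain ⟨O, -, hpO, η, hη, hsub⟩ := isOpen_iff.1 hV p hpV
  refine ⟨η, hη, fun q hqp hηq r (hqr : q ≤ r.seq) => hsub ?_⟩
  rcases le_or_exists_branchesOff p.seq r.seq with hle | ⟨α, hα⟩
  · have hseq : r.seq = p.seq :=
      (hle.eq_or_lt.resolve_right fun hlt => p.notMem hp (r.mem_of_lt _ hlt)).symm
    refine Or.inl ⟨hseq, ?_⟩
    rwa [r.lab_eq_base (hseq ▸ hp), ← p.lab_eq_base hp]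
  · have hqα : q.len ≤ α := by
      by_contra! hlt
      refine hα.2.2.elim (hlt.trans_le hqr.1).ne fun hne => hne ?_
      exact ((lt_iff.1 hqp).2 hlt).symm.trans (hqr.2 hlt)
    refine Or.inr ⟨α, hηq.trans_le hqα, hα, ?_⟩
    rwa [D.anchor_eq_base _ hp, ← p.lab_eq_base hp]

theorem lindelofSpace [LindelofSpace Y] (hW : ∀ s : Set W, s.Countable → ∃ w, ∀ ξ ∈ s, ξ < w)
    (hbranch : ∀ x : W → ℕ, ∃ β, restrict x β ∉ T) (hthin : IsThin T)
    (hP : MeetsLimitPaths T D.admissible) : LindelofSpace (PathSpace T D) := by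
  refine ⟨isLindelof_of_countable_subcover fun {ι} U hU hcov' => ?_⟩
  have hcov (p) : ∃ i, p ∈ U i := Set.mem_iUnion.1 (hcov' (Set.mem_univ p))
  change CountablyCovered U Set.univ
  by_contra huniv
  obtain ⟨w⟩ : Nonempty W := (hW ∅ Set.countable_empty).nonempty
  let b : W := wellFounded_lt.min Set.univ ⟨w, trivial⟩
  let Q : Set (InitSeq W) := {q | ¬ CountablyCovered U (cone T D q)}
  have hQne : Q.Nonempty := by
    refine ⟨restrict 0 b, fun h => huniv (h.mono fun p _ => restrict_le_iff.2
      ⟨wellFounded_lt.min_le (Set.mem_univ _), fun ξ hξ => ?_⟩)⟩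
    exact absurd hξ (wellFounded_lt.min_le (Set.mem_univ ξ)).not_gt
  obtain ⟨M₀, hM₀Q, hM₀, hM₀ne, hM₀chain⟩ := exists_countable_subset_not_isChain hQne
    fun q hq => not_isChain_not_countablyCovered hU hcov hbranch hq
  obtain ⟨δ, M, hMM₀, hM⟩ := exists_isPerfectTree hM₀ne
    ((hW _ (hM₀.image len)).imp fun w hw q hq => hw _ ⟨q, hq, rfl⟩) hM₀chain
  have hMcount : M.Countable := hM₀.mono hMM₀
  have hMT : M ⊆ T := fun q hq => mem_of_not_countablyCovered_cone hU hcov (hM₀Q (hMM₀ hq))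
  have hδ : ¬ HasUncountableCof δ := hM.not_hasUncountableCof hMcount
  obtain ⟨z, ⟨rfl, hzT, hzmax, hzM⟩, hzP⟩ := hP δ M (fun q hq => ⟨hMT hq, hM.len_lt q hq⟩) hMcount
    (hM.not_countable_limitPaths hMcount hthin hMT)
  let p : PathSpace T D :=
    ⟨z, D.base, hM.isSuccLimit, hzT, fun _ => hzmax, fun _ => hzP, fun _ => rfl⟩
  obtain ⟨i, hi⟩ := hcov p
  obtain ⟨η, hη, hcone⟩ := exists_cone_subset_of_isOpen (p := p) hδ (hU i) hi
  obtain ⟨η', hη', hlt⟩ := hM.isSuccLimit.lt_iff_exists_lt.1 hη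
  obtain ⟨q, hq, hle, hqz⟩ := hzM η' hη'
  exact hM₀Q (hMM₀ hq) (.of_subset (hcone q hqz (hlt.trans_le hle)))

end PathSpace

/-! ### The spaces associated with a thin tree -/

theorem mk_iUnion_le_aleph_one {α ι : Type u} {s : ι → Set α} (hι : #ι ≤ ℵ₁)
    (hs : ∀ i, #(s i) ≤ ℵ₁) : #(⋃ i, s i) ≤ ℵ₁ :=
  calc #(⋃ i, s i) ≤ #ι * ⨆ i, #(s i) := Cardinal.mk_iUnion_le s
    _ ≤ ℵ₁ * ℵ₁ := mul_le_mul' hι (ciSup_le' hs)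
    _ = ℵ₁ := Cardinal.mul_eq_self (Cardinal.aleph0_le_aleph 1)

theorem mk_countable_subsets_le {α : Type u} (hCH : (2 : Cardinal.{u}) ^ ℵ₀ = ℵ₁) {A : Set α}
    (hA : #A ≤ ℵ₁) : #{S : Set α // S ⊆ A ∧ S.Countable} ≤ ℵ₁ := by
  simp only [← Cardinal.le_aleph0_iff_set_countable]
  calc #{S : Set α // S ⊆ A ∧ #S ≤ ℵ₀} ≤ max #A ℵ₀ ^ ℵ₀ := Cardinal.mk_bounded_subset_le A ℵ₀
    _ ≤ ((2 : Cardinal.{u}) ^ ℵ₀) ^ ℵ₀ :=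
      Cardinal.power_le_power_right (max_le (hA.trans hCH.ge) (Cardinal.cantor ℵ₀).le)
    _ = ℵ₁ := by rw [← Cardinal.power_mul, Cardinal.aleph0_mul_aleph0, hCH]

namespace InitSeq

variable {W : Type u} [LinearOrder W] [WellFoundedLT W] {T : LowerSet (InitSeq W)}

theorem IsThin.mk_level_le (hT : IsThin T) (hW : ∀ w : W, #(Set.Iio w) ≤ ℵ₁) (β : W) :
    #{z | z ∈ T ∧ z.len = β} ≤ ℵ₁ := by
  induction β using WellFoundedLT.induction with
  | ind β ih =>
  by_cases hβ : IsMin β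
  · refine (Cardinal.mk_le_one_iff_set_subsingleton.2 fun z hz w hw => ?_).trans
      (Cardinal.one_le_aleph0.trans (Cardinal.aleph0_le_aleph 1))
    refine eq_of_eqOn (hz.2.trans hw.2.symm) fun ξ hξ => ?_
    exact (hβ.not_lt (hz.2 ▸ hξ)).elim
  obtain ⟨G, hG, hGT⟩ := hT β hβ
  let level (t : Set.Iio β × G) : Set (InitSeq W) :=
    {z | (z ∈ T ∧ z.len = β) ∧ Set.EqOn z.val t.2 (Set.Ico t.1 β)}
  have hsub : {z | z ∈ T ∧ z.len = β} ⊆ ⋃ t, level t := fun z hz => by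
    obtain ⟨f, hf, η, hη, heq⟩ := hGT z hz.1 hz.2
    exact Set.mem_iUnion.2 ⟨(⟨η, hη⟩, ⟨f, hf⟩), hz, heq⟩
  refine (Cardinal.mk_le_mk_of_subset hsub).trans (mk_iUnion_le_aleph_one ?_ fun t => ?_)
  · rw [Cardinal.mk_prod, Cardinal.lift_id, Cardinal.lift_id]
    exact (mul_le_mul' (hW β) (hG.le_aleph0.trans (Cardinal.aleph0_le_aleph 1))).trans
      (Cardinal.mul_eq_self (Cardinal.aleph0_le_aleph 1)).le
  · have hinj : Set.InjOn (fun z => restrict z.val t.1.1) (level t) := fun z hz w hw h => by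
      refine eq_of_eqOn (hz.1.2.trans hw.1.2.symm) fun ξ hξ => ?_
      rw [Set.mem_Iio, hz.1.2] at hξ
      rcases lt_or_ge ξ t.1.1 with hlt | hge
      · exact eqOn_of_restrict_eq h hlt
      · exact (hz.2 ⟨hge, hξ⟩).trans (hw.2 ⟨hge, hξ⟩).symm
    rw [← Cardinal.mk_image_eq_of_injOn _ _ hinj]
    refine (Cardinal.mk_le_mk_of_subset ?_).trans (ih t.1 t.1.2)
    rintro _ ⟨z, ⟨⟨hz, hlen⟩, -⟩, rfl⟩
    exact ⟨T.lower (restrict_le_iff.2 ⟨hlen ▸ t.1.2.le, Set.eqOn_refl _ _⟩) hz, rfl⟩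

theorem IsThin.mk_setOf_len_lt_le (hT : IsThin T) (hW : ∀ w : W, #(Set.Iio w) ≤ ℵ₁) (δ : W) :
    #{q | q ∈ T ∧ q.len < δ} ≤ ℵ₁ := by
  have hsub : {q | q ∈ T ∧ q.len < δ} ⊆ ⋃ β : Set.Iio δ, {q | q ∈ T ∧ q.len = β} :=
    fun q hq => Set.mem_iUnion.2 ⟨⟨q.len, hq.2⟩, hq.1, rfl⟩
  exact (Cardinal.mk_le_mk_of_subset hsub).trans
    (mk_iUnion_le_aleph_one (hW δ) fun β => hT.mk_level_le hW β)

theorem exists_meetsLimitPaths (hCH : (2 : Cardinal.{u}) ^ ℵ₀ = ℵ₁)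
    (hW : ∀ w : W, #(Set.Iio w) ≤ ℵ₁) (hT : IsThin T) :
    ∃ P, MeetsLimitPaths T P ∧ MeetsLimitPaths T Pᶜ := by
  have hsplit (δ : W) : ∃ P : Set (InitSeq W), ∀ M ⊆ {q | q ∈ T ∧ q.len < δ}, M.Countable →
      ¬ (limitPaths T δ M).Countable →
      (limitPaths T δ M ∩ P).Nonempty ∧ (limitPaths T δ M ∩ Pᶜ).Nonempty := by
    let ι := {M : {M : Set (InitSeq W) // M ⊆ {q | q ∈ T ∧ q.len < δ} ∧ M.Countable} //
      ¬ (limitPaths T δ M.1).Countable}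
    have hι : #ι ≤ ℵ₁ :=
      (Cardinal.mk_subtype_le _).trans (mk_countable_subsets_le hCH (hT.mk_setOf_len_lt_le hW δ))
    obtain ⟨P, hP⟩ := exists_splitting_set hι (S := fun M : ι => limitPaths T δ M.1) Subtype.prop
    exact ⟨P, fun M hMT hM h => hP ⟨⟨M, hMT, hM⟩, h⟩⟩
  choose P hP using hsplit
  refine ⟨{q | q ∈ P q.len}, fun δ M hMT hM h => ?_, fun δ M hMT hM h => ?_⟩
  · obtain ⟨z, hz, hzP⟩ := (hP δ M hMT hM h).1
    exact ⟨z, hz, show z ∈ P z.len from hz.1 ▸ hzP⟩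
  · obtain ⟨z, hz, hzP⟩ := (hP δ M hMT hM h).2
    exact ⟨z, hz, show z ∉ P z.len from hz.1 ▸ hzP⟩

end InitSeq

namespace PathSpaceData

variable {W Y I : Type*} [LinearOrder W]

open Classical in
/-- The data in which the places at which a path can be left are mapped to `Y` through a rank map
and an injective family of points of `Y`. -/
noncomputable def ofRankMap (A : Set (InitSeq W)) (y₀ : Y) (y : I ↪ Y) (ψ : W → W → I)
    (hψ : ∀ l, ¬ IsMin l → IsRankMap l (ψ l)) : PathSpaceData W Y where
  admissible := A
  base := y₀
  anchor l α := if HasUncountableCof l then y (ψ l α) else y₀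
  exists_bound_of_anchor_eq l hl p := by
    simp only [if_pos hl]
    by_cases hp : ∃ i, y i = p
    · obtain ⟨i, rfl⟩ := hp
      simpa only [y.apply_eq_iff_eq] using (hψ l hl.isSuccLimit.1).1 i
    · obtain ⟨b, hb⟩ := not_isMin_iff.1 hl.isSuccLimit.1
      exact ⟨b, hb, fun α _ h => absurd ⟨_, h⟩ hp⟩
  anchor_eq_of_mem_Ioc l μ hμ hcof := by
    obtain ⟨η, hη, h⟩ := (hψ l (not_isMin_iff.2 ⟨μ, hμ⟩)).2 μ hμ hcof
    exact ⟨η, hη, fun α hα => by rw [h α hα]⟩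
  anchor_eq_base l hl α := if_neg hl

theorem anchor_ofRankMap {A : Set (InitSeq W)} {y₀ : Y} {y : I ↪ Y} {ψ : W → W → I}
    {hψ : ∀ l, ¬ IsMin l → IsRankMap l (ψ l)} {l : W} (hl : HasUncountableCof l) (α : W) :
    (ofRankMap A y₀ y ψ hψ).anchor l α = y (ψ l α) :=
  if_pos hl

end PathSpaceData

theorem isClosed_and_isDiscrete_of_subsingleton {X : Type*} [TopologicalSpace X] [T1Space X]
    {C : Set X} (hC : ∀ x, ∃ U, IsOpen U ∧ x ∈ U ∧ (U ∩ C).Subsingleton) :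
    IsClosed C ∧ IsDiscrete C := by
  refine isClosed_and_discrete_iff.2 fun x => ?_
  obtain ⟨U, hU, hxU, hUC⟩ := hC x
  have hopen : IsOpen (U \ ((U ∩ C) \ {x})) :=
    hU.sdiff (hUC.anti Set.sdiff_subset).finite.isClosed
  refine Filter.disjoint_principal_right.2
    (mem_nhdsWithin.2 ⟨_, hopen, ⟨hxU, fun h => h.2 rfl⟩, ?_⟩)
  exact fun y hy hyC => hy.1.2 ⟨⟨hy.1.1, hyC⟩, hy.2⟩

namespace PathSpace

open PathSpaceData

section Diagonal

variable {W Y Y' I : Type*} [LinearOrder W] {T : LowerSet (InitSeq W)}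
  {A A' : Set (InitSeq W)} {y₀ : Y} {y₀' : Y'} {y : I ↪ Y} {y' : I ↪ Y'} {ψ : W → W → I}
  {hψ : ∀ l, ¬ IsMin l → IsRankMap l (ψ l)}

variable (T A A' y₀ y₀' y y' ψ hψ) in
/-- The pairs of points on a common path that carry the base labels. -/
def baseDiagonal :
    Set (PathSpace T (ofRankMap A y₀ y ψ hψ) × PathSpace T (ofRankMap A' y₀' y' ψ hψ)) :=
  {x | x.1.seq = x.2.seq ∧ x.1.lab = y₀ ∧ x.2.lab = y₀'}

theorem subset_image_baseDiagonal {Z : Set (InitSeq W)}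
    (hZ : ∀ z ∈ Z, HasUncountableCof z.len ∧ ∀ s < z, s ∈ T) :
    Z ⊆ (fun x => x.1.seq) '' baseDiagonal T A A' y₀ y₀' y y' ψ hψ := fun z hz => by
  obtain ⟨hcof, hT⟩ := hZ z hz
  exact ⟨(⟨z, y₀, hcof.isSuccLimit, hT, absurd hcof, absurd hcof, fun _ => rfl⟩,
    ⟨z, y₀', hcof.isSuccLimit, hT, absurd hcof, absurd hcof, fun _ => rfl⟩), ⟨rfl, rfl, rfl⟩, rfl⟩

variable [WellFoundedLT W] [TopologicalSpace Y] [TopologicalSpace Y']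

/-- If the points `(y i, y' i)` are closed and discrete, then paths that leave the common path of
`p` and `q` at the same large place are not close to both `p` and `q`. -/
theorem exists_isOpen_forall_seq_eq_imp (hA : Disjoint A A')
    (hy : ∀ a b, ∃ U V, IsOpen U ∧ IsOpen V ∧ a ∈ U ∧ b ∈ V ∧
      {i | y i ∈ U ∧ y' i ∈ V}.Subsingleton)
    (p : PathSpace T (ofRankMap A y₀ y ψ hψ)) (q : PathSpace T (ofRankMap A' y₀' y' ψ hψ)) :
    ∃ U V, IsOpen U ∧ IsOpen V ∧ p ∈ U ∧ q ∈ V ∧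
      ∀ p' ∈ U, ∀ q' ∈ V, p'.seq = q'.seq → p'.seq = p.seq := by
  by_cases hpq : p.seq = q.seq
  swap
  · obtain ⟨U, V, hU, hV, hp, hq, h⟩ := exists_isOpen_forall_seq_ne hpq
    exact ⟨U, V, hU, hV, hp, hq, fun p' hp' q' hq' heq => absurd heq (h p' hp' q' hq')⟩
  have hcof : HasUncountableCof p.seq.len := by
    by_contra h
    exact hA.le_bot ⟨p.mem_admissible h, hpq ▸ q.mem_admissible (hpq ▸ h)⟩
  obtain ⟨U, V, hU, hV, hp, hq, hUV⟩ := hy p.lab q.lab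
  obtain ⟨η, hη, hbound⟩ : ∃ η < p.seq.len, ∀ α < p.seq.len,
      y (ψ p.seq.len α) ∈ U → y' (ψ p.seq.len α) ∈ V → α ≤ η := by
    rcases hUV.eq_empty_or_singleton with hempty | ⟨i, hi⟩
    · obtain ⟨η, hη⟩ := p.exists_lt
      exact ⟨η, hη, fun α _ h h' => absurd ⟨h, h'⟩ (Set.eq_empty_iff_forall_notMem.1 hempty _)⟩
    · obtain ⟨η, hη, h⟩ := (hψ _ hcof.isSuccLimit.1).1 i
      exact ⟨η, hη, fun α hα h₁ h₂ => h α hα (Set.eq_of_mem_singleton (hi ▸ ⟨h₁, h₂⟩))⟩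
  refine ⟨_, _, isOpen_nbd_seq p hU hη, isOpen_nbd_seq q hV (hpq ▸ hη), mem_nbd_self hp,
    mem_nbd_self hq, ?_⟩
  rintro p' (⟨hseq, -⟩ | ⟨α, hα, hbr, hαU⟩) q' hq' heq
  · exact hseq
  · have hαV := ((mem_nbd_iff_of_branchesOff (hpq ▸ heq ▸ hbr)).1 hq').2
    rw [← hpq] at hαV
    rw [anchor_ofRankMap hcof] at hαU hαV
    exact absurd (hbound α hbr.1 hαU hαV) hα.not_ge

theorem isClosed_and_isDiscrete_baseDiagonal [T1Space Y] [T1Space Y'] (hA : Disjoint A A')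
    (hy : ∀ a b, ∃ U V, IsOpen U ∧ IsOpen V ∧ a ∈ U ∧ b ∈ V ∧
      {i | y i ∈ U ∧ y' i ∈ V}.Subsingleton) :
    IsClosed (baseDiagonal T A A' y₀ y₀' y y' ψ hψ) ∧
      IsDiscrete (baseDiagonal T A A' y₀ y₀' y y' ψ hψ) := by
  refine isClosed_and_isDiscrete_of_subsingleton fun x => ?_
  obtain ⟨U, V, hU, hV, hxU, hxV, h⟩ := exists_isOpen_forall_seq_eq_imp hA hy x.1 x.2
  refine ⟨U ×ˢ V, hU.prod hV, ⟨hxU, hxV⟩, ?_⟩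
  rintro a ⟨⟨haU, haV⟩, haseq, ha, ha'⟩ b ⟨⟨hbU, hbV⟩, hbseq, hb, hb'⟩
  have hab : a.1.seq = b.1.seq := (h _ haU _ haV haseq).trans (h _ hbU _ hbV hbseq).symm
  exact Prod.ext (PathSpace.ext hab (ha.trans hb.symm))
    (PathSpace.ext (haseq.symm.trans (hab.trans hbseq)) (ha'.trans hb'.symm))

end Diagonal

end PathSpace

theorem mk_le_extent {X : Type*} [TopologicalSpace X] {C : Set X} (hC : IsClosed C)
    (hC' : IsDiscrete C) : #C ≤ extent X :=
  le_ciSup (f := fun C : {C : Set X // IsClosed C ∧ DiscreteTopology C} => #C.1)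
    Cardinal.bddAbove_of_small ⟨C, hC, hC'.to_subtype⟩

/-- The ordinals below `ω₁`. -/
abbrev OmegaOne : Type := (ℵ₁ : Cardinal.{0}).ord.ToType

theorem countable_Iio_omegaOne (i : OmegaOne) : (Set.Iio i).Countable := by
  rw [← Cardinal.le_aleph0_iff_set_countable, ← Order.lt_succ_iff, Cardinal.succ_aleph0]
  simpa using Cardinal.mk_Iio_lt i

theorem exists_forall_isRankMap {W : Type} [LinearOrder W] [WellFoundedLT W]
    (hW : ∀ w : W, #(Set.Iio w) ≤ ℵ₁) :
    ∃ ψ : W → W → OmegaOne, ∀ l, ¬ IsMin l → IsRankMap l (ψ l) := by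
  have hψ (l : W) (hl : ¬ IsMin l) : ∃ ψ : W → OmegaOne, IsRankMap l ψ := by
    obtain ⟨rank⟩ : Nonempty (Set.Iio l ↪ OmegaOne) := by
      rw [← Cardinal.le_def, Cardinal.mk_ord_toType]
      exact hW l
    exact exists_isRankMap countable_Iio_omegaOne hl rank
  have : Nonempty OmegaOne := by
    rw [← Cardinal.mk_ne_zero_iff, Cardinal.mk_ord_toType]
    exact (Cardinal.aleph_pos 1).ne'
  choose! ψ hψ using hψ
  exact ⟨ψ, hψ⟩

/-- A thin tree of sequences on which no sequence of full length runs, although it has more than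
`ω₁` paths of uncountable cofinality. Both hypotheses of the theorem provide such a tree, with
`W = ω₂`. -/
structure IsThinKurepa {W : Type*} [LinearOrder W] (T : LowerSet (InitSeq W)) : Prop where
  isThin : IsThin T
  exists_restrict_notMem : ∀ x : W → ℕ, ∃ β, restrict x β ∉ T
  card_paths : ℵ₁ < #{z : InitSeq W | HasUncountableCof z.len ∧ ∀ s < z, s ∈ T}

theorem IsThinKurepa.exists_spaces {W : Type} [LinearOrder W] [WellFoundedLT W]
    {T : LowerSet (InitSeq W)} (hT : IsThinKurepa T) (hCH : (2 : Cardinal.{0}) ^ ℵ₀ = ℵ₁)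
    (hW : ∀ w : W, #(Set.Iio w) ≤ ℵ₁)
    (hbdd : ∀ s : Set W, s.Countable → ∃ w, ∀ ξ ∈ s, ξ < w) :
    ∃ (X₀ X₁ : Type) (_ : TopologicalSpace X₀) (_ : TopologicalSpace X₁),
      (RegularSpace X₀ ∧ T1Space X₀ ∧ LindelofSpace X₀ ∧ ∀ x : X₀, IsGδ ({x} : Set X₀)) ∧
      (RegularSpace X₁ ∧ T1Space X₁ ∧ LindelofSpace X₁ ∧ ∀ x : X₁, IsGδ ({x} : Set X₁)) ∧
      (2 : Cardinal.{0}) ^ ℵ₀ < extent (X₀ × X₁) := by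
  obtain ⟨hthin, hbranch, hcard⟩ := hT
  obtain ⟨P, hP, hP'⟩ := exists_meetsLimitPaths hCH hW hthin
  obtain ⟨ψ, hψ⟩ := exists_forall_isRankMap hW
  obtain ⟨r⟩ : Nonempty (OmegaOne ↪ ℝ) := by
    rw [← Cardinal.le_def, Cardinal.mk_ord_toType, Cardinal.mk_real, ← Cardinal.two_power_aleph0,
      hCH]
  let y₀ : SorgenfreyLine := SorgenfreyLine.toReal.symm 0
  let y : OmegaOne ↪ SorgenfreyLine := r.trans SorgenfreyLine.toReal.symm.toEmbedding
  let y' : OmegaOne ↪ SorgenfreyLine :=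
    r.trans ((Equiv.neg ℝ).trans SorgenfreyLine.toReal.symm).toEmbedding
  let D := PathSpaceData.ofRankMap P y₀ y ψ hψ
  let D' := PathSpaceData.ofRankMap Pᶜ y₀ y' ψ hψ
  have hG := SorgenfreyLine.isGδ_singleton
  refine ⟨PathSpace T D, PathSpace T D', inferInstance, inferInstance,
    ⟨inferInstance, inferInstance, PathSpace.lindelofSpace hbdd hbranch hthin hP,
      PathSpace.isGδ_singleton hG⟩,
    ⟨inferInstance, inferInstance, PathSpace.lindelofSpace hbdd hbranch hthin hP',
      PathSpace.isGδ_singleton hG⟩, ?_⟩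
  have hanti (a b : SorgenfreyLine) : ∃ U V, IsOpen U ∧ IsOpen V ∧ a ∈ U ∧ b ∈ V ∧
      {i | y i ∈ U ∧ y' i ∈ V}.Subsingleton := by
    obtain ⟨U, V, hU, hV, ha, hb, h⟩ :=
      SorgenfreyLine.exists_isOpen_antidiagonal_subsingleton a b
    exact ⟨U, V, hU, hV, ha, hb, h.preimage r.injective⟩
  obtain ⟨hclosed, hdiscrete⟩ := PathSpace.isClosed_and_isDiscrete_baseDiagonal (T := T)
    (y₀ := y₀) (y₀' := y₀) (hψ := hψ) (disjoint_compl_right (a := P)) hanti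
  calc (2 : Cardinal.{0}) ^ ℵ₀ < #{z : InitSeq W | HasUncountableCof z.len ∧ ∀ s < z, s ∈ T} :=
      hCH.trans_lt hcard
    _ ≤ _ := (Cardinal.mk_le_mk_of_subset
      (PathSpace.subset_image_baseDiagonal fun _ hz => hz)).trans Cardinal.mk_image_le
    _ ≤ extent (PathSpace T D × PathSpace T D') := mk_le_extent hclosed hdiscrete

/-- The ordinals below `ω₂`. -/
abbrev OmegaTwo : Type := (ω_ 2 : Ordinal.{0}).ToType

theorem mk_omegaTwo : #OmegaTwo = Order.succ ℵ₁ := by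
  rw [Cardinal.mk_toType, Ordinal.card_omega, Cardinal.succ_aleph, one_add_one_eq_two]

theorem cof_omegaTwo : Order.cof OmegaTwo = Order.succ ℵ₁ := by
  rw [Ordinal.cof_toType, ← one_add_one_eq_two, Cardinal.cof_omega_add_one, Cardinal.succ_aleph]

instance : IsRegularCardinalOrder OmegaTwo where
  type_lt_le_ord_cof := by
    rw [cof_omegaTwo, Ordinal.type_toType, Cardinal.succ_aleph, one_add_one_eq_two,
      Cardinal.ord_aleph]

theorem mk_Iio_omegaTwo_le (w : OmegaTwo) : #(Set.Iio w) ≤ ℵ₁ := by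
  rw [← Order.lt_succ_iff, ← mk_omegaTwo]
  exact Cardinal.mk_Iio_lt w Cardinal.ord_cardinalMk

theorem aleph0_lt_cof_omegaTwo : ℵ₀ < Order.cof OmegaTwo := by
  rw [cof_omegaTwo]
  exact (Cardinal.aleph0_le_aleph 1).trans_lt (Order.lt_succ _)

theorem exists_forall_lt_of_countable {W : Type u} [LinearOrder W] (hW : ℵ₀ < Order.cof W)
    {s : Set W} (hs : s.Countable) : ∃ w, ∀ ξ ∈ s, ξ < w :=
  not_isCofinal_iff.1 fun hcof => ((Order.cof_le hcof).trans hs.le_aleph0).not_gt hW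

theorem hasUncountableCof_iff_cof_toOrd {w : OmegaTwo} :
    HasUncountableCof w ↔ ℵ₀ < (w.toOrd : Ordinal).cof := by
  rw [HasUncountableCof, Order.cof_Iio]
  rfl

theorem toOrd_lt_toOrd {v w : OmegaTwo} : (v.toOrd : Ordinal) < w.toOrd ↔ v < w :=
  Ordinal.ToType.mk.symm.lt_iff_lt

theorem exists_toOrd_eq {o : Ordinal.{0}} (ho : o < ω_ 2) :
    ∃ w : OmegaTwo, (w.toOrd : Ordinal) = o :=
  ⟨Ordinal.ToType.mk ⟨o, ho⟩, by simp⟩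

/-! ### Kurepa trees -/

section Kurepa

variable {T : Type u} [PartialOrder T] [IsSetTree T] {s t : T} {B B' : Set T} {δ : Ordinal.{u}}

theorem treeHeight_strictMono : StrictMono (treeHeight : T → Ordinal) := by
  intro s t hst
  have := IsSetTree.isWellOrder_Iio s
  have := IsSetTree.isWellOrder_Iio t
  refine Ordinal.type_lt_iff.2 ⟨⟨⟨Set.inclusion (Set.Iio_subset_Iio hst.le),
    Set.inclusion_injective _⟩, Iff.rfl⟩, ⟨s, hst⟩, fun b => ?_⟩
  exact ⟨by rintro ⟨x, rfl⟩; exact x.2, fun hb => ⟨⟨b, hb⟩, rfl⟩⟩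

theorem eq_of_treeHeight_eq (hst : s ≤ t ∨ t ≤ s) (h : treeHeight s = treeHeight t) : s = t :=
  hst.elim (fun hle => hle.eq_of_not_lt fun hlt => (treeHeight_strictMono hlt).ne h)
    fun hle => (hle.eq_of_not_lt fun hlt => (treeHeight_strictMono hlt).ne' h).symm

theorem le_total_of_le {r : T} (hs : s ≤ r) (ht : t ≤ r) : s ≤ t ∨ t ≤ s := by
  rcases hs.eq_or_lt with rfl | hs
  · exact Or.inr ht
  rcases ht.eq_or_lt with rfl | ht
  · exact Or.inl hs.le
  have := IsSetTree.isWellOrder_Iio r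
  rcases trichotomous_of (· < · : Set.Iio r → Set.Iio r → Prop) ⟨s, hs⟩ ⟨t, ht⟩ with h | h | h
  · exact Or.inl (le_of_lt h)
  · exact Or.inl (congrArg Subtype.val h).le
  · exact Or.inr (le_of_lt h)

namespace IsCofinalBranch

theorem exists_node (hB : IsCofinalBranch B) (δ : Ordinal) :
    ∃ t ∈ B, δ < ω₁ → treeHeight t = δ := by
  by_cases hδ : δ < ω₁
  · obtain ⟨t, ht, hδt⟩ := hB.meets δ hδ
    exact ⟨t, ht, fun _ => hδt⟩
  · obtain ⟨t, ht, -⟩ := hB.meets 0 (Ordinal.omega_pos 1)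
    exact ⟨t, ht, fun h => absurd h hδ⟩

/-- The node of height `δ` on a cofinal branch, for `δ < ω₁`. -/
noncomputable def node (hB : IsCofinalBranch B) (δ : Ordinal) : T :=
  (hB.exists_node δ).choose

theorem node_mem (hB : IsCofinalBranch B) (δ : Ordinal) : hB.node δ ∈ B :=
  (hB.exists_node δ).choose_spec.1

theorem treeHeight_node (hB : IsCofinalBranch B) (hδ : δ < ω₁) : treeHeight (hB.node δ) = δ :=
  (hB.exists_node δ).choose_spec.2 hδ

theorem node_treeHeight (hB : IsCofinalBranch B) (ht : t ∈ B) (hlt : treeHeight t < ω₁) :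
    hB.node (treeHeight t) = t :=
  eq_of_treeHeight_eq (hB.isMaxChain.isChain.total (hB.node_mem _) ht) (hB.treeHeight_node hlt)

theorem node_le_node (hB : IsCofinalBranch B) {γ : Ordinal} (hγδ : γ ≤ δ) (hδ : δ < ω₁) :
    hB.node γ ≤ hB.node δ := by
  refine (hB.isMaxChain.isChain.total (hB.node_mem γ) (hB.node_mem δ)).elim id fun hle => ?_
  refine (eq_of_treeHeight_eq (Or.inr hle) ?_).le
  refine le_antisymm ?_ (treeHeight_strictMono.monotone hle)
  rwa [hB.treeHeight_node hδ, hB.treeHeight_node (hγδ.trans_lt hδ)]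

theorem node_eq_of_le (hB : IsCofinalBranch B) (hB' : IsCofinalBranch B') {γ : Ordinal}
    (hδ : δ < ω₁) (h : hB.node δ = hB'.node δ) (hγδ : γ ≤ δ) : hB.node γ = hB'.node γ := by
  refine eq_of_treeHeight_eq (le_total_of_le (hB.node_le_node hγδ hδ) ?_) ?_
  · rw [h]
    exact hB'.node_le_node hγδ hδ
  · rw [hB.treeHeight_node (hγδ.trans_lt hδ), hB'.treeHeight_node (hγδ.trans_lt hδ)]

theorem subset_of_forall_node_eq (hT : IsOmegaOneTree T) (hB : IsCofinalBranch B)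
    (hB' : IsCofinalBranch B') (h : ∀ δ < ω₁, hB.node δ = hB'.node δ) : B ⊆ B' := by
  intro t ht
  have hlt : treeHeight t < ω₁ := (hT.level_nonempty_iff _).1 ⟨t, rfl⟩
  rw [← hB.node_treeHeight ht hlt, h _ hlt]
  exact hB'.node_mem _

end IsCofinalBranch

theorem IsOmegaOneTree.exists_levelwise_injective (hT : IsOmegaOneTree T) :
    ∃ c : T → ℕ, ∀ s t, treeHeight s = treeHeight t → c s = c t → s = t := by
  choose f hf using fun α => Set.countable_iff_exists_injOn.1 (hT.level_countable α)
  refine ⟨fun t => f (treeHeight t) t, fun s t hst hc => hf (treeHeight t) hst rfl ?_⟩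
  simpa only [hst] using hc

theorem IsKurepaTree.exists_sequences (hT : IsKurepaTree T) :
    ∃ (J : Type u) (f : J → Ordinal.{u} → ℕ), ℵ₁ < #J ∧
      (∀ i j, Set.EqOn (f i) (f j) (Set.Iio ω₁) → i = j) ∧
      ∀ i j, ∀ δ < ω₁, f i δ = f j δ → Set.EqOn (f i) (f j) (Set.Iic δ) := by
  obtain ⟨c, hc⟩ := hT.isOmegaOneTree.exists_levelwise_injective
  have hnode (B B' : {B : Set T // IsCofinalBranch B}) (δ : Ordinal) (hδ : δ < ω₁)
      (h : c (B.2.node δ) = c (B'.2.node δ)) : B.2.node δ = B'.2.node δ :=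
    hc _ _ (by rw [B.2.treeHeight_node hδ, B'.2.treeHeight_node hδ]) h
  refine ⟨{B : Set T // IsCofinalBranch B}, fun B δ => c (B.2.node δ), hT.card_branches,
    fun B B' h => ?_, fun B B' δ hδ h γ hγ => ?_⟩
  · have h' (δ : Ordinal) (hδ : δ < ω₁) : B.2.node δ = B'.2.node δ := hnode B B' δ hδ (h hδ)
    exact Subtype.ext <| Set.Subset.antisymm
      (B.2.subset_of_forall_node_eq hT.isOmegaOneTree B'.2 h')
      (B'.2.subset_of_forall_node_eq hT.isOmegaOneTree B.2 fun δ hδ => (h' δ hδ).symm)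
  · exact congrArg c (B.2.node_eq_of_le B'.2 hδ (hnode B B' δ hδ h) hγ)

end Kurepa

/-- The tree of the proper initial segments of the sequences `f i` restricted to `l`. -/
def initialSegments {W I : Type*} [LinearOrder W] (l : W) (f : I → W → ℕ) :
    LowerSet (InitSeq W) where
  carrier := {s | ∃ i, s < restrict (f i) l}
  lower' := fun _ _ hle ⟨i, hi⟩ => ⟨i, hle.trans_lt hi⟩

theorem isThin_initialSegments {W I : Type*} [LinearOrder W] {l : W} {f : I → W → ℕ}
    (hf : ∀ i j, ∀ δ < l, f i δ = f j δ → Set.EqOn (f i) (f j) (Set.Iic δ)) :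
    IsThin (initialSegments l f) := by
  intro δ hδ
  obtain ⟨η, hη⟩ := not_isMin_iff.1 hδ
  choose j hj using fun k : Set.range (f · δ) => k.2
  refine ⟨Set.range fun k => f (j k), Set.countable_range _, ?_⟩
  rintro z ⟨i, hi⟩ rfl
  obtain ⟨hlt, hval⟩ := lt_restrict_iff.1 hi
  refine ⟨f (j ⟨f i z.len, i, rfl⟩), ⟨_, rfl⟩, η, hη, fun ξ hξ => ?_⟩
  rw [hval hξ.2, hf _ _ z.len hlt (hj ⟨f i z.len, i, rfl⟩) hξ.2.le]

theorem IsKurepaTree.exists_isThinKurepa {T : Type} [PartialOrder T] [IsSetTree T]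
    (hT : IsKurepaTree T) : ∃ T' : LowerSet (InitSeq OmegaTwo), IsThinKurepa T' := by
  obtain ⟨J, f, hJ, hinj, hcoh⟩ := hT.exists_sequences
  have hlt : ω₁ < ω_ 2 := Ordinal.omega_lt_omega.2 one_lt_two
  obtain ⟨l, hl⟩ := exists_toOrd_eq hlt
  have hlcof : HasUncountableCof l := by
    rw [hasUncountableCof_iff_cof_toOrd, hl, Cardinal.cof_omega_one]
    exact Cardinal.aleph0_lt_aleph_one
  let g (j : J) (ξ : OmegaTwo) : ℕ := f j ξ.toOrd
  have hthin : IsThin (initialSegments l g) := isThin_initialSegments fun i j δ hδ h ξ hξ =>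
    hcoh i j _ (hl ▸ toOrd_lt_toOrd.2 hδ) h (Ordinal.ToType.mk.symm.monotone hξ)
  have hginj : Function.Injective fun j => restrict (g j) l := by
    refine fun i j h => hinj i j fun o ho => ?_
    obtain ⟨ξ, rfl⟩ := exists_toOrd_eq (ho.trans hlt)
    have hξ : ξ < l := toOrd_lt_toOrd.1 (hl ▸ ho)
    exact eqOn_of_restrict_eq h hξ
  refine ⟨initialSegments l g, hthin, fun x => ⟨l, fun ⟨j, hj⟩ => (lt_restrict_iff.1 hj).1.false⟩,
    ?_⟩
  rw [← Cardinal.mk_range_eq _ hginj] at hJ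
  refine hJ.trans_le (Cardinal.mk_le_mk_of_subset ?_)
  rintro _ ⟨j, rfl⟩
  exact ⟨hlcof, fun s hs => ⟨j, hs⟩⟩

/-! ### Clubs and stationary sets -/

section Club

variable {W : Type u} [LinearOrder W] {S : Set W} {β ξ : W}

/-- `β` is a limit point of `S`. In a well-order this says that `β` is an accumulation point of `S`
for the order topology. -/
def IsLimitPoint (β : W) (S : Set W) : Prop :=
  ¬ IsMin β ∧ ∀ ξ < β, (S ∩ Set.Ioo ξ β).Nonempty

theorem IsLimitPoint.isLUB (h : IsLimitPoint β S) : IsLUB (S ∩ Set.Iio β) β := by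
  refine ⟨fun x hx => hx.2.le, fun b hb => le_of_not_gt fun hlt => ?_⟩
  obtain ⟨γ, hγ, hbγ, hγβ⟩ := h.2 b hlt
  exact hbγ.not_ge (hb ⟨hγ, hγβ⟩)

theorem IsLimitPoint.nonempty (h : IsLimitPoint β S) : (S ∩ Set.Iio β).Nonempty := by
  obtain ⟨ξ, hξ⟩ := not_isMin_iff.1 h.1
  exact (h.2 ξ hξ).mono (Set.inter_subset_inter_right _ Set.Ioo_subset_Iio_self)

theorem isLimitPoint_of_isLUB (h : IsLUB S β) (hne : S.Nonempty) (hβ : β ∉ S) :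
    IsLimitPoint β S := by
  have hlt (γ : W) (hγ : γ ∈ S) : γ < β := (h.1 hγ).lt_of_ne (ne_of_mem_of_not_mem hγ hβ)
  obtain ⟨γ, hγ⟩ := hne
  refine ⟨not_isMin_iff.2 ⟨γ, hlt γ hγ⟩, fun ξ hξ => ?_⟩
  obtain ⟨ζ, hζ, hξζ⟩ := (lt_isLUB_iff h).1 hξ
  exact ⟨ζ, hζ, hξζ, hlt ζ hζ⟩

theorem IsLimitPoint.mono {S' : Set W} (h : IsLimitPoint β S) (hS : S ∩ Set.Iio β ⊆ S') :
    IsLimitPoint β S' :=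
  ⟨h.1, fun ξ hξ => (h.2 ξ hξ).imp fun _ hγ => ⟨hS ⟨hγ.1, hγ.2.2⟩, hγ.2⟩⟩

theorem dirSupClosed_of_isLimitPoint (h : ∀ β, IsLimitPoint β S → β ∈ S) : DirSupClosed S := by
  refine dirSupClosed_iff_of_linearOrder.2 fun d hd hne β hβ => by_contra fun hβS => hβS ?_
  have hlim : IsLimitPoint β d := isLimitPoint_of_isLUB hβ hne fun hβd => hβS (hd hβd)
  exact h β (hlim.mono (Set.inter_subset_left.trans hd))

theorem noMaxOrder_of_aleph0_lt_cof (hW : ℵ₀ < Order.cof W) : NoMaxOrder W where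
  exists_gt a := (exists_forall_lt_of_countable hW (Set.countable_singleton a)).imp
    fun _ h => h a rfl

theorem isClub_Ioi [NoMaxOrder W] (a : W) : IsClub (Set.Ioi a) where
  dirSupClosed := (isUpperSet_Ioi a).dirSupClosed
  isCofinal b := (exists_gt (max a b)).imp fun _ h =>
    ⟨(le_max_left a b).trans_lt h, (le_max_right a b).trans h.le⟩

variable [WellFoundedLT W]

theorem exists_isLUB_of_countable (hW : ℵ₀ < Order.cof W) (hS : S.Countable) :
    ∃ w, IsLUB S w := by
  have hne : (upperBounds S).Nonempty :=
    (exists_forall_lt_of_countable hW hS).imp fun _ h ξ hξ => (h ξ hξ).le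
  exact ⟨wellFounded_lt.min _ hne, WellFounded.min_mem _ _ hne,
    fun _ hb => WellFounded.min_le wellFounded_lt hb⟩

variable [IsRegularCardinalOrder W] {C : W → Set W}

theorem mk_Iic_lt_cof [NoMaxOrder W] (w : W) : #(Set.Iic w) < Order.cof W := by
  obtain ⟨v, hv⟩ := exists_gt w
  rw [Order.cof_eq_cardinalMk]
  exact (Cardinal.mk_le_mk_of_subset (Set.Iic_subset_Iio.2 hv)).trans_lt
    (Cardinal.mk_Iio_lt v Cardinal.ord_cardinalMk)

theorem isClub_diagonalInter (hW : ℵ₀ < Order.cof W) (hC : ∀ i, IsClub (C i)) :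
    IsClub {δ | ∀ i < δ, δ ∈ C i} := by
  have := noMaxOrder_of_aleph0_lt_cof hW
  refine ⟨dirSupClosed_iff_of_linearOrder.2 fun d hd _ δ hδ i hi => ?_, fun a => ?_⟩
  · obtain ⟨x, hx, hix⟩ := (lt_isLUB_iff hδ).1 hi
    refine (hC i).isLUB_mem (t := d ∩ Set.Ici x) (fun y hy => hd hy.1 i (hix.trans_le hy.2))
      ⟨x, hx, le_rfl⟩ ((hδ.inter_Ici_of_mem hx))
  have hinter (b : W) : IsClub (⋂ i : Set.Iic b, C i) :=
    IsClub.iInter hW.ne' (by simpa using mk_Iic_lt_cof b) fun i => hC i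
  have hnext (b : W) : ∃ b', b < b' ∧ ∀ i ≤ b, b' ∈ C i := by
    obtain ⟨b', hb', -⟩ := ((hinter b).inter hW.ne' (isClub_Ioi b)).isCofinal b
    exact ⟨b', hb'.2, fun i hi => Set.mem_iInter.1 hb'.1 ⟨i, hi⟩⟩
  choose f hlt hf using hnext
  have hmono : StrictMono fun n => f^[n] a := strictMono_nat_of_lt_succ fun n => by
    rw [Function.iterate_succ_apply']
    exact hlt _
  obtain ⟨δ, hδ⟩ := exists_isLUB_of_countable hW (Set.countable_range fun n => f^[n] a)
  refine ⟨δ, fun i hi => ?_, hδ.1 ⟨0, rfl⟩⟩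
  obtain ⟨_, ⟨n, rfl⟩, hn⟩ := (lt_isLUB_iff hδ).1 hi
  suffices htail : Set.range (fun n => f^[n] a) ∩ Set.Ici (f^[n + 1] a) ⊆ C i from
    (hC i).isLUB_mem htail ⟨_, Set.mem_range_self (n + 1), le_rfl⟩
      (hδ.inter_Ici_of_mem (Set.mem_range_self (n + 1)))
  rintro _ ⟨⟨k, rfl⟩, hk⟩
  have hnk : n + 1 ≤ k := hmono.le_iff_le.1 hk
  obtain ⟨k, rfl⟩ := Nat.exists_eq_add_of_le' (n.succ_pos.trans_le hnk)
  simp only [Function.iterate_succ_apply']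
  exact hf _ i (hn.le.trans (hmono.monotone (Nat.le_of_succ_le_succ hnk)))

theorem isClub_setOf_forall_lt (hW : ℵ₀ < Order.cof W) (F : W → W) :
    IsClub {δ | ∀ ξ < δ, F ξ < δ} :=
  have := noMaxOrder_of_aleph0_lt_cof hW
  isClub_diagonalInter hW fun ξ => isClub_Ioi (F ξ)

theorem isClub_setOf_isSuccLimit (hW : ℵ₀ < Order.cof W) :
    IsClub {δ : W | Order.IsSuccLimit δ} := by
  have := noMaxOrder_of_aleph0_lt_cof hW
  let := SuccOrder.ofLinearWellFoundedLT W
  obtain ⟨w, -⟩ := exists_forall_lt_of_countable hW Set.countable_empty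
  have : Nonempty W := ⟨w⟩
  let := WellFoundedLT.toOrderBot (α := W)
  convert (isClub_Ioi (⊥ : W)).inter hW.ne' (isClub_setOf_forall_lt hW Order.succ) using 1
  ext δ
  rw [Set.mem_ofPred_eq, Order.isSuccLimit_iff, isMin_iff_eq_bot, Set.mem_inter_iff, Set.mem_Ioi,
    bot_lt_iff_ne_bot, Order.isSuccPrelimit_iff_succ_lt, Set.mem_ofPred_eq]

/-- The pressing-down lemma. -/
theorem exists_isStationary_fiber (hW : ℵ₀ < Order.cof W) (hS : IsStationary S)
    {e : W → W} (he : ∀ δ ∈ S, e δ < δ) : ∃ η, IsStationary {δ ∈ S | e δ = η} := by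
  by_contra! h
  choose C hC hdisj using fun η => not_isStationary_iff.1 (h η)
  obtain ⟨δ, hδ, hδC⟩ := hS (isClub_diagonalInter hW hC)
  exact (hdisj (e δ)).notMem_of_mem_left ⟨hδ, rfl⟩ (hδC _ (he δ hδ))

end Club

/-! ### Square sequences -/

section Transfer

variable {W X : Type*} [LinearOrder W] [LinearOrder X] {β : W} {S : Set W}

theorem isLimitPoint_preimage {f : W → X} (hf : StrictMono f) (hrange : IsLowerSet (Set.range f))
    {S : Set X} : IsLimitPoint β (f ⁻¹' S) ↔ IsLimitPoint (f β) S := by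
  have hex (o : X) (ho : o < f β) : ∃ ξ < β, f ξ = o := by
    obtain ⟨ξ, rfl⟩ := hrange ho.le ⟨β, rfl⟩
    exact ⟨ξ, hf.lt_iff_lt.1 ho, rfl⟩
  refine and_congr ?_ ⟨fun h o ho => ?_, fun h ξ hξ => ?_⟩
  · rw [not_isMin_iff, not_isMin_iff]
    exact ⟨fun ⟨ξ, hξ⟩ => ⟨f ξ, hf hξ⟩, fun ⟨o, ho⟩ => (hex o ho).imp fun _ h => h.1⟩
  · obtain ⟨ξ, hξ, rfl⟩ := hex o ho
    obtain ⟨γ, hγ, hξγ, hγβ⟩ := h ξ hξ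
    exact ⟨f γ, hγ, hf hξγ, hf hγβ⟩
  · obtain ⟨o, ho, hξo, hoβ⟩ := h (f ξ) (hf hξ)
    obtain ⟨γ, hγ, rfl⟩ := hex o hoβ
    exact ⟨γ, ho, hf.lt_iff_lt.1 hξo, hγ⟩

theorem isClub_iff_isLimitPoint : IsClub S ↔ IsCofinal S ∧ ∀ β, IsLimitPoint β S → β ∈ S :=
  ⟨fun h => ⟨h.isCofinal, fun _ hβ => h.isLUB_mem Set.inter_subset_left hβ.nonempty hβ.isLUB⟩,
    fun h => ⟨dirSupClosed_of_isLimitPoint h.2, h.1⟩⟩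

theorem isClubIn_iff {c : Set Ordinal.{u}} {α : Ordinal.{u}} :
    IsClubIn c α ↔ c ⊆ Set.Iio α ∧ (∀ ξ < α, ∃ γ ∈ c, ξ ≤ γ) ∧
      ∀ β < α, IsLimitPoint β c → β ∈ c := by
  refine and_congr_right fun hc => isClub_iff_isLimitPoint.trans (and_congr ?_ ?_)
  · refine ⟨fun h ξ hξ => ?_, fun h ξ => ?_⟩
    · obtain ⟨γ, hγ, hξγ⟩ := h ⟨ξ, hξ⟩
      exact ⟨γ, hγ, hξγ⟩
    · obtain ⟨γ, hγ, hξγ⟩ := h ξ ξ.2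
      exact ⟨⟨γ, hc hγ⟩, hγ, hξγ⟩
  · have hlim (β : Set.Iio α) := isLimitPoint_preimage (β := β) (S := c)
      (Subtype.strictMono_coe (Set.Iio α)) (by
        rw [Subtype.range_coe]
        exact isLowerSet_Iio α)
    exact Subtype.forall.trans (forall₂_congr fun β hβ => imp_congr_left (hlim ⟨β, hβ⟩))

variable {κ : Ordinal.{u}} {f : W → Ordinal.{u}}

theorem isClubIn_image (hf : StrictMono f) (hrange : Set.range f = Set.Iio κ) (hS : IsClub S) :
    IsClubIn (f '' S) κ := by
  refine isClubIn_iff.2 ⟨hrange ▸ Set.image_subset_range f S, fun o ho => ?_, fun o ho h => ?_⟩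
  · obtain ⟨ξ, rfl⟩ := hrange.superset ho
    obtain ⟨γ, hγ, hle⟩ := hS.isCofinal ξ
    exact ⟨f γ, Set.mem_image_of_mem f hγ, hf.monotone hle⟩
  · obtain ⟨β, rfl⟩ := hrange.superset ho
    rw [← isLimitPoint_preimage hf (hrange ▸ isLowerSet_Iio κ),
      Set.preimage_image_eq S hf.injective] at h
    exact Set.mem_image_of_mem f ((isClub_iff_isLimitPoint.1 hS).2 β h)

/-- A `□`-sequence indexed by the well-order `W`, the analogue for `W` of the sequences in
`TodorcevicSquare`. -/
structure IsSquareSeq {W : Type*} [LinearOrder W] (c : W → Set W) : Prop where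
  subset_Iio : ∀ α, c α ⊆ Set.Iio α
  exists_le : ∀ α, ∀ ξ < α, ∃ γ ∈ c α, ξ ≤ γ
  mem_of_isLimitPoint : ∀ α, ∀ β < α, IsLimitPoint β (c α) → β ∈ c α
  eq_inter_Iio : ∀ α, ∀ β < α, IsLimitPoint β (c α) → c β = c α ∩ Set.Iio β
  nontrivial : ¬ ∃ D, IsClub D ∧ ∀ α, IsLimitPoint α D → D ∩ Set.Iio α = c α

theorem TodorcevicSquare.exists_isSquareSeq (h : TodorcevicSquare κ) (hf : StrictMono f)
    (hrange : Set.range f = Set.Iio κ) : ∃ c : W → Set W, IsSquareSeq c := by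
  obtain ⟨C, hclub, hcoh, hnontriv⟩ := h
  have hlt (α : W) : f α < κ := hrange.subset (Set.mem_range_self α)
  have hlim {β : W} {S : Set Ordinal} : IsLimitPoint β (f ⁻¹' S) ↔ IsLimitPoint (f β) S :=
    isLimitPoint_preimage hf (hrange ▸ isLowerSet_Iio κ)
  have hpre (α : W) : f ⁻¹' Set.Iio (f α) = Set.Iio α := Set.ext fun _ => hf.lt_iff_lt
  have hC (α : W) := isClubIn_iff.1 (hclub (f α) (hlt α))
  refine ⟨fun α => f ⁻¹' C (f α), fun α γ hγ => hf.lt_iff_lt.1 ((hC α).1 hγ), fun α ξ hξ => ?_,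
    fun α β hβ h => (hC α).2.2 _ (hf hβ) (hlim.1 h), fun α β hβ h => ?_, ?_⟩
  · obtain ⟨o, ho, hle⟩ := (hC α).2.1 (f ξ) (hf hξ)
    obtain ⟨γ, rfl⟩ := hrange.superset (((hC α).1 ho).trans (hlt α))
    exact ⟨γ, ho, hf.le_iff_le.1 hle⟩
  · rw [hcoh _ (hlt α) _ (hf hβ) (SuccOrder.accPt_principal.2 (hlim.1 h)), Set.preimage_inter,
      hpre]
  · rintro ⟨D, hD, hDC⟩
    refine hnontriv ⟨f '' D, isClubIn_image hf hrange hD, fun o ho h => ?_⟩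
    obtain ⟨α, rfl⟩ := hrange.superset ho
    have hα : IsLimitPoint α D := by
      rwa [SuccOrder.accPt_principal, ← IsLimitPoint, ← hlim,
        Set.preimage_image_eq D hf.injective] at h
    rw [← Set.image_inter_preimage, hpre, hDC α hα,
      Set.image_preimage_eq_of_subset
        (((hC α).1.trans (Set.Iio_subset_Iio (hlt α).le)).trans hrange.superset)]

end Transfer

namespace IsSquareSeq

variable {W : Type*} [LinearOrder W] [NoMaxOrder W] {c : W → Set W} {S E : Set W}

theorem exists_inter_Iio_ne (hc : IsSquareSeq c) (hE : IsCofinal E) (D : Set W) :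
    ∃ ε ∈ E, D ∩ Set.Iio ε ≠ c ε := by
  by_contra! h
  have hex (ξ : W) : ∃ ε ∈ E, ξ < ε := by
    obtain ⟨ξ', hξ'⟩ := exists_gt ξ
    obtain ⟨ε, hε, hle⟩ := hE ξ'
    exact ⟨ε, hε, hξ'.trans_le hle⟩
  have hlim {β ε : W} (hε : ε ∈ E) (hβε : β < ε) (hβ : IsLimitPoint β D) :
      IsLimitPoint β (c ε) :=
    hβ.mono fun γ hγ => (h ε hε).subset ⟨hγ.1, lt_trans hγ.2 hβε⟩
  refine hc.nontrivial ⟨D, isClub_iff_isLimitPoint.2 ⟨fun ξ => ?_, fun β hβ => ?_⟩, fun α hα => ?_⟩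
  · obtain ⟨ε, hε, hξε⟩ := hex ξ
    obtain ⟨γ, hγ, hle⟩ := hc.exists_le ε ξ hξε
    exact ⟨γ, ((h ε hε).superset hγ).1, hle⟩
  · obtain ⟨ε, hε, hβε⟩ := hex β
    exact ((h ε hε).superset (hc.mem_of_isLimitPoint ε β hβε (hlim hε hβε hβ))).1
  · obtain ⟨ε, hε, hαε⟩ := hex α
    rw [hc.eq_inter_Iio ε α hαε (hlim hε hαε hα), ← h ε hε, Set.inter_assoc,
      Set.inter_eq_self_of_subset_right (Set.Iio_subset_Iio hαε.le)]

theorem exists_not_isLimitPoint (hc : IsSquareSeq c) (hS : IsCofinal S) (hE : IsCofinal E) :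
    ∃ δ ∈ S, ∃ ε ∈ E, ε < δ ∧ ¬ IsLimitPoint ε (c δ) := by
  by_contra! h
  obtain ⟨ε, hε, hne⟩ := hc.exists_inter_Iio_ne hE (⋃ ε ∈ E, c ε)
  refine hne (Set.Subset.antisymm ?_ fun γ hγ =>
    ⟨Set.mem_biUnion hε hγ, hc.subset_Iio ε hγ⟩)
  rintro γ ⟨hγ, hγε⟩
  obtain ⟨ε', hε', hγ⟩ := Set.mem_iUnion₂.1 hγ
  obtain ⟨ζ, hζ⟩ := exists_gt (max ε ε')
  obtain ⟨δ, hδ, hζδ⟩ := hS ζ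
  obtain ⟨hεδ, hε'δ⟩ := max_lt_iff.1 (hζ.trans_le hζδ)
  have hγδ := (hc.eq_inter_Iio δ ε' hε'δ (h δ hδ ε' hε' hε'δ)).subset hγ
  exact (hc.eq_inter_Iio δ ε hεδ (h δ hδ ε hε hεδ)).superset ⟨hγδ.1, hγε⟩

end IsSquareSeq

/-! ### Walks along a square sequence -/

section Walk

variable {W : Type u} [LinearOrder W] [WellFoundedLT W] {c : W → Set W}
  {α γ δ ε ξ η ζ : W} {f : W → ℕ} {k l : ℕ}

open Classical in
/-- The number of steps of the walk from `α` down to `ξ` along `c`, each step of which goes from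
`α` to the least element of `c α` that is at least `ξ`. The walk stops when there is no such
element below `α`. -/
noncomputable def walk (c : W → Set W) (ξ α : W) : ℕ :=
  if h : (c α ∩ Set.Ico ξ α).Nonempty then walk c ξ (wellFounded_lt.min _ h) + 1 else 0
termination_by wellFounded_lt.wrap α
decreasing_by exact (WellFounded.min_mem wellFounded_lt _ h).2.2

namespace IsSquareSeq

theorem exists_isLeast (hc : IsSquareSeq c) (h : ξ < α) : ∃ γ, IsLeast (c α ∩ Set.Ici ξ) γ := by
  have hne : (c α ∩ Set.Ici ξ).Nonempty := hc.exists_le α ξ h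
  exact ⟨_, WellFounded.min_mem wellFounded_lt _ hne,
    fun _ hγ => WellFounded.min_le wellFounded_lt hγ⟩

theorem walk_eq_of_isLeast (hc : IsSquareSeq c) (hγ : IsLeast (c α ∩ Set.Ici ξ) γ) :
    walk c ξ α = walk c ξ γ + 1 := by
  have hmem : γ ∈ c α ∩ Set.Ico ξ α := ⟨hγ.1.1, hγ.1.2, hc.subset_Iio α hγ.1.1⟩
  have hmin := WellFounded.min_mem wellFounded_lt _ ⟨γ, hmem⟩
  rw [walk, dif_pos ⟨γ, hmem⟩, le_antisymm (WellFounded.min_le wellFounded_lt hmem)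
    (hγ.2 ⟨hmin.1, hmin.2.1⟩)]

theorem walk_eq_of_isLimitPoint (hc : IsSquareSeq c) (hδ : δ < α) (hlim : IsLimitPoint δ (c α))
    (hξ : ξ < δ) : walk c ξ α = walk c ξ δ := by
  obtain ⟨γ, hγ⟩ := hc.exists_isLeast hξ
  have hγδ : γ < δ := hc.subset_Iio δ hγ.1.1
  have hcoh := hc.eq_inter_Iio α δ hδ hlim
  rw [hc.walk_eq_of_isLeast hγ]
  refine hc.walk_eq_of_isLeast ⟨⟨(hcoh.subset hγ.1.1).1, hγ.1.2⟩, fun γ' hγ' => ?_⟩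
  rcases lt_or_ge γ' δ with hlt | hle
  · exact hγ.2 ⟨hcoh.superset ⟨hγ'.1, hlt⟩, hγ'.2⟩
  · exact hγδ.le.trans hle

theorem isLimitPoint_or_exists_walk_eq (hc : IsSquareSeq c) (hδ : Order.IsSuccLimit δ)
    (h : δ < α) : IsLimitPoint δ (c α) ∨
      ∃ k, ∃ η < δ, Set.EqOn (walk c · α) (walk c · δ + (k + 1)) (Set.Ico η δ) := by
  induction α using WellFoundedLT.induction with
  | _ α ih =>
  refine or_iff_not_imp_left.2 fun hlim => ?_
  obtain ⟨η, hη, hempty⟩ : ∃ η < δ, ∀ ζ ∈ c α, η < ζ → δ ≤ ζ := by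
    simpa [IsLimitPoint, hδ.not_isMin, Set.Nonempty] using hlim
  obtain ⟨η', hη'δ, hηη'⟩ := hδ.lt_iff_exists_lt.1 hη
  obtain ⟨γ, hγ⟩ := hc.exists_isLeast h
  have hstep : Set.EqOn (walk c · α) (walk c · γ + 1) (Set.Ico η' δ) := fun ξ hξ =>
    hc.walk_eq_of_isLeast ⟨⟨hγ.1.1, hξ.2.le.trans hγ.1.2⟩, fun ζ hζ =>
      hγ.2 ⟨hζ.1, hempty ζ hζ.1 (hηη'.trans_le (hξ.1.trans hζ.2))⟩⟩
  rcases (show δ ≤ γ from hγ.1.2).eq_or_lt with rfl | hδγ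
  · exact ⟨0, η', hη'δ, hstep⟩
  rcases ih γ (hc.subset_Iio α hγ.1.1) hδγ with hlim' | ⟨k, ζ, hζ, hk⟩
  · refine ⟨0, η', hη'δ, fun ξ hξ => (hstep hξ).trans ?_⟩
    simp only [hc.walk_eq_of_isLimitPoint hδγ hlim' hξ.2]
  · refine ⟨k + 1, max η' ζ, max_lt hη'δ hζ, fun ξ hξ => ?_⟩
    exact (hstep ⟨(le_max_left _ _).trans hξ.1, hξ.2⟩).trans
      (congrArg (· + 1) (hk ⟨(le_max_right _ _).trans hξ.1, hξ.2⟩))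

theorem exists_walk_eq_add (hc : IsSquareSeq c) (hδ : Order.IsSuccLimit δ) (h : δ ≤ α) :
    ∃ k, ∃ η < δ, Set.EqOn (walk c · α) (walk c · δ + k) (Set.Ico η δ) := by
  obtain ⟨η, hη⟩ := not_isMin_iff.1 hδ.not_isMin
  rcases h.eq_or_lt with rfl | h
  · exact ⟨0, η, hη, fun _ _ => rfl⟩
  rcases hc.isLimitPoint_or_exists_walk_eq hδ h with hlim | ⟨k, ζ, hζ, hk⟩
  · exact ⟨0, η, hη, fun ξ hξ => hc.walk_eq_of_isLimitPoint h hlim hξ.2⟩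
  · exact ⟨k + 1, ζ, hζ, hk⟩

theorem isLimitPoint_of_eqOn (hc : IsSquareSeq c) (hε : Order.IsSuccLimit ε) (hεδ : ε < δ)
    (hη : η < ε) (hζ : ζ < ε) (hkl : k ≤ l) (hfε : Set.EqOn f (walk c · ε + k) (Set.Ico η ε))
    (hfδ : Set.EqOn f (walk c · δ + l) (Set.Ico ζ δ)) : IsLimitPoint ε (c δ) := by
  refine (hc.isLimitPoint_or_exists_walk_eq hε hεδ).resolve_right ?_
  rintro ⟨j, ι, hι, hj⟩
  have hlt : max η (max ζ ι) < ε := max_lt hη (max_lt hζ hι)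
  have h₁ := hfε ⟨le_max_left _ _, hlt⟩
  have h₂ := hfδ ⟨(le_max_left _ _).trans (le_max_right _ _), hlt.trans hεδ⟩
  have h₃ := hj ⟨(le_max_right _ _).trans (le_max_right _ _), hlt⟩
  simp only at h₁ h₂ h₃
  lia

end IsSquareSeq

end Walk

section NoBranch

variable {W : Type u} [LinearOrder W]

theorem exists_isCofinal_fiber (hW : ℵ₀ < Order.cof W) (f : W → ℕ) :
    ∃ m, IsCofinal {ξ | f ξ = m} := by
  by_contra! h
  choose b hb using fun m => not_isCofinal_iff.1 (h m)
  obtain ⟨w, hw⟩ := exists_forall_lt_of_countable hW (Set.countable_range b)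
  exact (hb (f w) w rfl).not_gt (hw _ ⟨_, rfl⟩)

variable [WellFoundedLT W]

theorem exists_isClub_le_isStationary_fiber (hW : ℵ₀ < Order.cof W) {k : W → ℕ} (m : ℕ)
    {C₀ : Set W} (hC₀ : IsClub C₀) (hk : ∀ δ ∈ C₀, k δ ≤ m) :
    ∃ C ⊆ C₀, ∃ n, IsClub C ∧ (∀ δ ∈ C, k δ ≤ n) ∧ IsStationary {δ ∈ C | k δ = n} := by
  induction m generalizing C₀ with
  | zero =>
    obtain ⟨w, -⟩ := exists_forall_lt_of_countable hW Set.countable_empty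
    have : Nonempty W := ⟨w⟩
    exact ⟨C₀, subset_rfl, 0, hC₀, hk, (hC₀.isStationary hW.ne').mono
      fun δ hδ => ⟨hδ, Nat.le_zero.1 (hk δ hδ)⟩⟩
  | succ m ih =>
    by_cases hstat : IsStationary {δ ∈ C₀ | k δ = m + 1}
    · exact ⟨C₀, subset_rfl, m + 1, hC₀, hk, hstat⟩
    obtain ⟨C', hC', hdisj⟩ := not_isStationary_iff.1 hstat
    obtain ⟨C, hC, hn⟩ := ih (hC₀.inter hW.ne' hC') fun δ hδ => Nat.le_of_lt_succ <|
      (hk δ hδ.1).lt_of_ne fun h => hdisj.notMem_of_mem_left ⟨hδ.1, h⟩ hδ.2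
    exact ⟨C, hC.trans Set.inter_subset_left, hn⟩

namespace IsSquareSeq

variable {c : W → Set W} {f : W → ℕ}

theorem exists_offset (hc : IsSquareSeq c)
    (hf : ∀ β, ∃ α, β ≤ α ∧ Set.EqOn (walk c · α) f (Set.Iio β)) :
    ∃ (k : W → ℕ) (e : W → W), ∀ δ, Order.IsSuccLimit δ →
      e δ < δ ∧ Set.EqOn f (walk c · δ + k δ) (Set.Ico (e δ) δ) := by
  have hoffset (δ : W) : ∃ k : ℕ, ∃ e, Order.IsSuccLimit δ →
      e < δ ∧ Set.EqOn f (walk c · δ + k) (Set.Ico e δ) := by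
    by_cases hδ : Order.IsSuccLimit δ
    · obtain ⟨α, hα, hfα⟩ := hf δ
      obtain ⟨k, e, he, hk⟩ := hc.exists_walk_eq_add hδ hα
      exact ⟨k, e, fun _ => ⟨he, fun ξ hξ => (hfα hξ.2).symm.trans (hk hξ)⟩⟩
    · exact ⟨0, δ, fun h => absurd h hδ⟩
  choose k e hke using hoffset
  exact ⟨k, e, hke⟩

theorem exists_not_eqOn_walk [IsRegularCardinalOrder W] (hc : IsSquareSeq c)
    (hW : ℵ₀ < Order.cof W) (f : W → ℕ) :
    ∃ β, ∀ α, β ≤ α → ¬ Set.EqOn (walk c · α) f (Set.Iio β) := by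
  by_contra! hf
  have := noMaxOrder_of_aleph0_lt_cof hW
  obtain ⟨k, e, hke⟩ := hc.exists_offset hf
  obtain ⟨m, hm⟩ := exists_isCofinal_fiber hW f
  choose F hFm hF using hm
  let C₀ : Set W := {δ | Order.IsSuccLimit δ} ∩ {δ | ∀ ξ < δ, F ξ < δ}
  have hC₀ : IsClub C₀ :=
    (isClub_setOf_isSuccLimit hW).inter hW.ne' (isClub_setOf_forall_lt hW F)
  have hkm : ∀ δ ∈ C₀, k δ ≤ m := by
    rintro δ ⟨hδ, hFδ⟩
    obtain ⟨he, hk⟩ := hke δ hδ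
    have hkF := hk ⟨hF (e δ), hFδ _ he⟩
    exact le_of_add_le_right (hkF.symm.trans (hFm (e δ))).le
  obtain ⟨C, hCC₀, n, hC, hkn, hstat⟩ := exists_isClub_le_isStationary_fiber hW m hC₀ hkm
  obtain ⟨η, hη⟩ := exists_isStationary_fiber hW hstat fun δ hδ => (hke δ (hCC₀ hδ.1).1).1
  have hη_cofinal : IsCofinal {δ ∈ {δ ∈ C | k δ = n} | e δ = η} := fun ξ =>
    (hη (isClub_Ioi ξ)).imp fun δ hδ => ⟨hδ.1, hδ.2.le⟩
  obtain ⟨δ, ⟨⟨hδ, rfl⟩, rfl⟩, ε, ⟨hε, hηε⟩, hεδ, hnot⟩ :=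
    hc.exists_not_isLimitPoint hη_cofinal (hC.inter hW.ne' (isClub_Ioi η)).isCofinal
  obtain ⟨heε, hfε⟩ := hke ε (hCC₀ hε).1
  exact hnot (hc.isLimitPoint_of_eqOn (hCC₀ hε).1 hεδ heε hηε (hkn ε hε) hfε
    (hke δ (hCC₀ hδ).1).2)

end IsSquareSeq

end NoBranch

section WalkTree

variable {W : Type u} [LinearOrder W] [WellFoundedLT W] {c : W → Set W}

/-- The tree of the initial segments of the functions `ξ ↦ walk c ξ α`. -/
noncomputable def walkTree (c : W → Set W) : LowerSet (InitSeq W) where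
  carrier := {s | ∃ α, s ≤ restrict (walk c · α) α}
  lower' := fun _ _ hle ⟨α, hα⟩ => ⟨α, hle.trans hα⟩

theorem IsSquareSeq.isThin_walkTree (hc : IsSquareSeq c) : IsThin (walkTree c) := by
  intro δ hδ
  by_cases hlim : Order.IsSuccLimit δ
  · refine ⟨Set.range fun (k : ℕ) ξ => walk c ξ δ + k, Set.countable_range _, ?_⟩
    rintro z ⟨α, hα⟩ rfl
    obtain ⟨hlen, hval⟩ := le_restrict_iff.1 hα
    obtain ⟨k, η, hη, hk⟩ := hc.exists_walk_eq_add hlim hlen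
    exact ⟨_, ⟨k, rfl⟩, η, hη, fun ξ hξ => (hval hξ.2).trans (hk hξ)⟩
  · obtain ⟨η, hη⟩ : ∃ η, η ⋖ δ := by
      simpa [Order.isSuccLimit_iff, hδ, Order.not_isSuccPrelimit_iff] using hlim
    refine ⟨Set.range fun (k : ℕ) _ => k, Set.countable_range _, fun z _ _ => ?_⟩
    refine ⟨_, ⟨z.val η, rfl⟩, η, hη.lt, fun ξ hξ => ?_⟩
    rw [show ξ = η from (hη.eq_or_eq hξ.1 hξ.2.le).resolve_right hξ.2.ne]

end WalkTree

theorem isCofinal_setOf_hasUncountableCof : IsCofinal {α : OmegaTwo | HasUncountableCof α} := by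
  intro w
  have hlt : (w.toOrd : Ordinal) + ω₁ < ω_ 2 :=
    Ordinal.isPrincipal_add_omega 2 w.toOrd.2 (Ordinal.omega_lt_omega.2 one_lt_two)
  obtain ⟨α, hα⟩ := exists_toOrd_eq hlt
  refine ⟨α, ?_, ?_⟩
  · rw [Set.mem_ofPred_eq, hasUncountableCof_iff_cof_toOrd, hα,
      Ordinal.cof_add _ (Ordinal.omega_pos 1).ne', Cardinal.cof_omega_one]
    exact Cardinal.aleph0_lt_aleph_one
  · refine (toOrd_lt_toOrd.1 ?_).le
    rw [hα]
    exact lt_add_of_pos_right _ (Ordinal.omega_pos 1)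

theorem aleph_one_lt_mk_hasUncountableCof : ℵ₁ < #{α : OmegaTwo // HasUncountableCof α} :=
  (Order.lt_succ ℵ₁).trans_le <|
    cof_omegaTwo.symm.le.trans (Order.cof_le isCofinal_setOf_hasUncountableCof)

theorem TodorcevicSquare.exists_isThinKurepa (h : TodorcevicSquare (ω_ 2 : Ordinal.{0})) :
    ∃ T : LowerSet (InitSeq OmegaTwo), IsThinKurepa T := by
  obtain ⟨c, hc⟩ := h.exists_isSquareSeq (f := fun α : OmegaTwo => (α.toOrd : Ordinal))
    (fun _ _ => toOrd_lt_toOrd.2)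
    (Set.Subset.antisymm (Set.range_subset_iff.2 fun α => α.toOrd.2) fun _ => exists_toOrd_eq)
  let b (α : {α : OmegaTwo // HasUncountableCof α}) : InitSeq OmegaTwo := restrict (walk c · α) α
  have hb : Function.Injective b := fun α α' h => Subtype.ext (congrArg InitSeq.len h)
  refine ⟨walkTree c, hc.isThin_walkTree, fun x => ?_, ?_⟩
  · obtain ⟨β, hβ⟩ := hc.exists_not_eqOn_walk aleph0_lt_cof_omegaTwo x
    refine ⟨β, fun ⟨α, hα⟩ => ?_⟩
    obtain ⟨hle, hval⟩ := le_restrict_iff.1 hα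
    exact hβ α hle (hval.symm.trans (eqOn_restrict x β))
  · refine aleph_one_lt_mk_hasUncountableCof.trans_le ?_
    rw [← Cardinal.mk_range_eq _ hb]
    refine Cardinal.mk_le_mk_of_subset ?_
    rintro _ ⟨α, rfl⟩
    exact ⟨α.2, fun s hs => ⟨α, hs.le⟩⟩

theorem theorem1p1
    (hCH : (2 : Cardinal.{0}) ^ ℵ₀ = ℵ₁)
    (h : (∃ (T : Type) (_ : PartialOrder T) (_ : IsSetTree T), IsKurepaTree T) ∨
      TodorcevicSquare (ω_ 2 : Ordinal.{0})) :
    ∃ (X₀ X₁ : Type) (_ : TopologicalSpace X₀) (_ : TopologicalSpace X₁),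
      (RegularSpace X₀ ∧ T1Space X₀ ∧ LindelofSpace X₀ ∧ ∀ x : X₀, IsGδ ({x} : Set X₀)) ∧
      (RegularSpace X₁ ∧ T1Space X₁ ∧ LindelofSpace X₁ ∧ ∀ x : X₁, IsGδ ({x} : Set X₁)) ∧
      (2 : Cardinal.{0}) ^ ℵ₀ < extent (X₀ × X₁) := by
  obtain ⟨T, hT⟩ : ∃ T : LowerSet (InitSeq OmegaTwo), IsThinKurepa T := by
    rcases h with ⟨_, _, _, hKurepa⟩ | hsquare
    · exact hKurepa.exists_isThinKurepa
    · exact hsquare.exists_isThinKurepa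
  exact hT.exists_spaces hCH mk_Iio_omegaTwo_le
    fun _ => exists_forall_lt_of_countable aleph0_lt_cof_omegaTwo
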